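/- For $N\ge 1$ let $\mathcal H_N\subset \mathrm{SL}(2,\mathbb R)^N$ be the hyperbolicity locus of the full $N$-shift: $(A_1,\dots,A_N)\in\mathcal H_N$ iff the cocycle $A^n(x)=A_{x_{n-1}}\cdots A_{x_0}$, $A^{-n}(x)=A_{x_{-n}}^{-1}\cdots A_{x_{-1}}^{-1}$ ($n\ge 0$) over the shift $\sigma$ on $\{1,\dots,N\}^{\mathbb Z}$ is uniformly hyperbolic, i.e. there are a continuous splitting $\mathbb R^2=E^s(x)\oplus E^u(x)$ with $A_{x_0}E^{s}(x)=E^{s}(\sigma x)$, $A_{x_0}E^{u}(x)=E^{u}(\sigma x)$, and constants $K>0$, $0<\lambda<1$ such that $\|A^n(x)v\|\le K\lambda^n\|v\|$ for $v\in E^s(x)$ and $\|A^{-n}(x)v\|\le K\lambda^n\|v\|$ for $v\in E^u(x)$, for all $x$ and all $n\ge0$. A hyperbolic component is a connected component of $\mathcal H_N$. The elliptic locus $\mathcal E\subset \mathrm{SL}(2,\mathbb R)^3$ is the set of triples having a product $M$ (of the three matrices, with repetitions, in any order) with $|\operatorname{tr} M|<2$. For a hyperbolic matrix $M$ (that is,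 $|\operatorname{tr}M|>2$), let $u_M,s_M\in\mathbb P^1$ be its unstable and stable directions: the eigendirections whose eigenvalue has modulus $>1$, respectively $<1$. Let $H_{\mathrm{id}}^+$ be the positive free component of the full $2$-shift: the pairs $(A,B)\in\mathrm{SL}(2,\mathbb R)^2$ with $\operatorname{tr}A>2$, $\operatorname{tr}B>2$, $\operatorname{tr}AB<-2$ and $$u_B<u_{BA}<s_{BA}<s_A<u_A<u_{AB}<s_{AB}<s_B<u_B$$ in the counterclockwise cyclic order on $\mathbb P^1$. Let $H\subset\mathrm{SL}(2,\mathbb R)^3$ be the hyperbolic component of the full $3$-shift that contains triples $(A,B,-AB)$ with $(A,B)\in H_{\mathrm{id}}^+$. **Proposition.** There exist $A,B\in\mathrm{SL}(2,\mathbb R)$ and a smooth path $t\in\mathbb R\mapsto C(t)\in \mathrm{SL}(2,\mathbb R)$ with the following properties: 1. $(A,B,C(t))\in H$ for every $t<0$. 2. At $t=0$ the heteroclinic connection $C(0)\cdot u_B=s_A$ occurs (with $A$ and $B$ hyperbolic), and $(A,B,C(0))\in\partial H$. 3. There exist pairwise distinct hyperbolic components $H_i$ $(i\in\mathbb N)$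 of the full $3$-shift and numbers $t_i>0$ with $t_i\to0$ such that $(A,B,C(t_i))\in H_i$ for all $i$. 4. There exist numbers $s_i>0$ with $s_i\to0$ such that $(A,B,C(s_i))\in\mathcal E$ for all $i$. In particular, every neighborhood of the boundary point $(A,B,C(0))$ of $H$ in $\mathrm{SL}(2,\mathbb R)^3$ meets infinitely many hyperbolic components. -/

import Mathlib

open Matrix Filter Topology
open scoped MatrixGroups ContDiff

/-- The product of the matrices read along the forward orbit of `x` under the shift:
`A^n(x) = A_{x_{n-1}} ⋯ A_{x_1} A_{x_0}`, for `n ≥ 0`. -/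
def forwardProduct {N : ℕ} (A : Fin N → SL(2, ℝ)) (x : ℤ → Fin N) : ℕ → SL(2, ℝ)
  | 0 => 1
  | n + 1 => A (x (n : ℤ)) * forwardProduct A x n

/-- The product of the inverse matrices read along the backward orbit of `x` under the shift:
`A^{-n}(x) = (A_{x_{-n}})⁻¹ ⋯ (A_{x_{-2}})⁻¹ (A_{x_{-1}})⁻¹`, for `n ≥ 0`. -/
def backwardProduct {N : ℕ} (A : Fin N → SL(2, ℝ)) (x : ℤ → Fin N) : ℕ → SL(2, ℝ)
  | 0 => 1
  | n + 1 => (A (x (-((n : ℤ) + 1))))⁻¹ * backwardProduct A x n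

/-- Uniform hyperbolicity of an `N`-tuple over the full shift `(Fin N)^ℤ` (with the product of
the discrete topologies): there is a continuous invariant splitting `ℝ² = Eˢ(x) ⊕ Eᵘ(x)`,
with `Eˢ` uniformly exponentially contracted by the forward iterates of the cocycle and `Eᵘ`
uniformly exponentially contracted by the backward iterates.

The continuous splitting is recorded by the continuous family of idempotent matrices `P x`,
the projection onto `Eˢ(x) = range (P x)` along `Eᵘ(x) = ker (P x) = range (1 - P x)`; the
identity `A_{x_0} P(x) = P(σ x) A_{x_0}`, where `(σ x)_n = x_{n+1}`, is the invariance of both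
subbundles. -/
def UniformlyHyperbolic {N : ℕ} (A : Fin N → SL(2, ℝ)) : Prop :=
  ∃ P : (ℤ → Fin N) → Matrix (Fin 2) (Fin 2) ℝ,
    Continuous P ∧
    (∀ x, P x * P x = P x) ∧
    (∀ x, (A (x 0) : Matrix (Fin 2) (Fin 2) ℝ) * P x
      = P (fun n => x (n + 1)) * (A (x 0) : Matrix (Fin 2) (Fin 2) ℝ)) ∧
    ∃ K l : ℝ, 0 < K ∧ 0 < l ∧ l < 1 ∧
      (∀ x (n : ℕ) (v : Fin 2 → ℝ), P x *ᵥ v = v →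
        ‖(forwardProduct A x n : Matrix (Fin 2) (Fin 2) ℝ) *ᵥ v‖ ≤ K * l ^ n * ‖v‖) ∧
      (∀ x (n : ℕ) (v : Fin 2 → ℝ), P x *ᵥ v = 0 →
        ‖(backwardProduct A x n : Matrix (Fin 2) (Fin 2) ℝ) *ᵥ v‖ ≤ K * l ^ n * ‖v‖)

/-- The hyperbolicity locus of the full `N`-shift, a subset of `SL(2, ℝ)^N`. -/
def hyperbolicLocus (N : ℕ) : Set (Fin N → SL(2, ℝ)) :=
  {A | UniformlyHyperbolic A}

/-- The hyperbolic components: the connected components of the hyperbolicity locus. -/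
def IsHyperbolicComponent {N : ℕ} (H : Set (Fin N → SL(2, ℝ))) : Prop :=
  ∃ A ∈ hyperbolicLocus N, H = connectedComponentIn (hyperbolicLocus N) A

/-- The elliptic locus of the full `N`-shift: some product `M` of the given matrices is elliptic,
that is, `|tr M| < 2`. (The empty product has trace `2`.) -/
def ellipticLocus (N : ℕ) : Set (Fin N → SL(2, ℝ)) :=
  {A | ∃ w : List (Fin N),
    |Matrix.trace ((w.map A).prod : Matrix (Fin 2) (Fin 2) ℝ)| < 2}

/-- The nonzero vector `v` spans the unstable direction `u_M`: it is an eigenvector whose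
eigenvalue has modulus greater than one. Such a `v` exists iff `M` is hyperbolic, and is then
unique up to a scalar. -/
def SpansUnstable (M : SL(2, ℝ)) (v : Fin 2 → ℝ) : Prop :=
  v ≠ 0 ∧ ∃ μ : ℝ, 1 < |μ| ∧ (M : Matrix (Fin 2) (Fin 2) ℝ) *ᵥ v = μ • v

/-- The nonzero vector `v` spans the stable direction `s_M`: it is an eigenvector whose
eigenvalue has modulus less than one. -/
def SpansStable (M : SL(2, ℝ)) (v : Fin 2 → ℝ) : Prop :=
  v ≠ 0 ∧ ∃ μ : ℝ, |μ| < 1 ∧ (M : Matrix (Fin 2) (Fin 2) ℝ) *ᵥ v = μ • v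

/-- The determinant of the pair of plane vectors `(v, w)`. -/
def planeDet (v w : Fin 2 → ℝ) : ℝ := v 0 * w 1 - v 1 * w 0

/-- The lines spanned by the nonzero vectors `d 0, …, d (n-1)` are pairwise distinct (if `n ≥ 3`)
and are met in this cyclic order when the projective line is run through counterclockwise. The
sign of the product below does not change when a vector is multiplied by a nonzero scalar; for
three lines at angles `0 ≤ a, b, c < π` it is positive iff `a < b < c`, `b < c < a` or
`c < a < b`. -/
def CyclicallyOrdered {n : ℕ} (d : Fin n → Fin 2 → ℝ) : Prop :=
  ∀ i j k : Fin n, i < j → j < k →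
    0 < planeDet (d i) (d j) * planeDet (d j) (d k) * planeDet (d i) (d k)

/-- `(A, B)` is in the positive free component of the full `2`-shift: `tr A > 2`, `tr B > 2`,
`tr AB < -2`, and, counterclockwise on the projective line,
`u_B < u_{BA} < s_{BA} < s_A < u_A < u_{AB} < s_{AB} < s_B < u_B`. -/
def InPositiveFreeComponent (A B : SL(2, ℝ)) : Prop :=
  2 < Matrix.trace (A : Matrix (Fin 2) (Fin 2) ℝ) ∧
  2 < Matrix.trace (B : Matrix (Fin 2) (Fin 2) ℝ) ∧
  Matrix.trace ((A * B : SL(2, ℝ)) : Matrix (Fin 2) (Fin 2) ℝ) < -2 ∧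
  ∃ uB uBA sBA sA uA uAB sAB sB : Fin 2 → ℝ,
    SpansUnstable B uB ∧ SpansUnstable (B * A) uBA ∧ SpansStable (B * A) sBA ∧
    SpansStable A sA ∧ SpansUnstable A uA ∧ SpansUnstable (A * B) uAB ∧
    SpansStable (A * B) sAB ∧ SpansStable B sB ∧
    CyclicallyOrdered ![uB, uBA, sBA, sA, uA, uAB, sAB, sB]

/-- The heteroclinic connection `C u_B = s_A`, with `A` and `B` hyperbolic. -/
def HeteroclinicConnection (A B C : SL(2, ℝ)) : Prop :=
  ∃ v : Fin 2 → ℝ, SpansUnstable B v ∧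
    SpansStable A ((C : Matrix (Fin 2) (Fin 2) ℝ) *ᵥ v)

/-!
A tuple is uniformly hyperbolic as soon as a finite family of cones in the plane is mapped strictly
inside itself: each letter maps each cone, up to a sign, into the interior of a cone of the family.
The quadratic forms of the cones then strictly increase along the cocycle, so a vector of one of the
cones is expanded between any two times. The vectors contracted most by `A^n(x)` converge to the
stable direction, and the unstable direction is found at a finite slope over the expanded vector, by
solving a contracting cohomological equation. Conversely, a product of trace less than two in
modulus has no real eigendirection, so the periodic words of a hyperbolic tuple have traces of
modulus at least two, and on a hyperbolic component each of these traces keeps its sign.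

The path is chosen such that `A * C t * B = C (49 * t)` and `C 0` maps `u_B` to `s_A`. For `t < 0`
the matrices mapping one suitable cone inside another form a connected set which contains `-AB` and
`C t` and consists of third letters of hyperbolic triples. At `t = 405 / 77 / 49 ^ n` the word
`Aⁿ C Bⁿ` is elliptic. At `t = 49⁻ⁿ / 4` the orbit of `u_B` under `Aᵏ C` stays off `s_A` with a
margin which is respected by `2 n + 3` cones, hence the triple is hyperbolic. The trace of
`Aⁿ C Bⁿ` is positive there, but negative at `49⁻ᵐ / 4` for all `m < n`, so these triples lie in
distinct components.
-/

/-! ### Plane geometry and the cocycle -/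

section Plane

lemma mulVec_eq_smul (M : SL(2, ℝ)) (v : Fin 2 → ℝ) :
    (M : Matrix (Fin 2) (Fin 2) ℝ) *ᵥ v = M • v := rfl

lemma smul_eq_vec (M : SL(2, ℝ)) (v : Fin 2 → ℝ) :
    M • v = ![M 0 0 * v 0 + M 0 1 * v 1, M 1 0 * v 0 + M 1 1 * v 1] := by
  rw [← mulVec_eq_smul]
  ext i
  fin_cases i <;> simp [mulVec, dotProduct]

@[simp]
lemma neg_matrix_smul (M : SL(2, ℝ)) (v : Fin 2 → ℝ) : -M • v = -(M • v) := by
  rw [← mulVec_eq_smul, ← mulVec_eq_smul, ← neg_mulVec, SpecialLinearGroup.coe_neg]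

lemma det_entries (M : SL(2, ℝ)) : M 0 0 * M 1 1 - M 0 1 * M 1 0 = 1 :=
  (det_fin_two _).symm.trans M.det_coe

@[simp]
lemma planeDet_self (v : Fin 2 → ℝ) : planeDet v v = 0 := by
  simp only [planeDet]; ring

lemma planeDet_comm (v w : Fin 2 → ℝ) : planeDet v w = -planeDet w v := by
  simp only [planeDet]; ring

@[simp]
lemma planeDet_add_left (u v w : Fin 2 → ℝ) :
    planeDet (u + v) w = planeDet u w + planeDet v w := by
  simp only [planeDet, Pi.add_apply]; ring

@[simp]
lemma planeDet_add_right (u v w : Fin 2 → ℝ) :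
    planeDet u (v + w) = planeDet u v + planeDet u w := by
  simp only [planeDet, Pi.add_apply]; ring

@[simp]
lemma planeDet_smul_left (a : ℝ) (v w : Fin 2 → ℝ) :
    planeDet (a • v) w = a * planeDet v w := by
  simp only [planeDet, Pi.smul_apply, smul_eq_mul]; ring

@[simp]
lemma planeDet_smul_right (a : ℝ) (v w : Fin 2 → ℝ) :
    planeDet v (a • w) = a * planeDet v w := by
  simp only [planeDet, Pi.smul_apply, smul_eq_mul]; ring

@[simp]
lemma planeDet_sub_right (u v w : Fin 2 → ℝ) :
    planeDet u (v - w) = planeDet u v - planeDet u w := by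
  simp only [planeDet, Pi.sub_apply]; ring

@[simp]
lemma planeDet_neg_left (v w : Fin 2 → ℝ) : planeDet (-v) w = -planeDet v w := by
  simp only [planeDet, Pi.neg_apply]; ring

@[simp]
lemma planeDet_neg_right (v w : Fin 2 → ℝ) : planeDet v (-w) = -planeDet v w := by
  simp only [planeDet, Pi.neg_apply]; ring

lemma planeDet_smul_smul (M : SL(2, ℝ)) (v w : Fin 2 → ℝ) :
    planeDet (M • v) (M • w) = planeDet v w := by
  simp only [planeDet, smul_eq_vec, cons_val_zero, cons_val_one]
  linear_combination (v 0 * w 1 - v 1 * w 0) * det_entries M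

lemma planeDet_smul_eq (v w z : Fin 2 → ℝ) :
    planeDet v w • z = planeDet z w • v + planeDet v z • w := by
  ext i
  fin_cases i <;> simp [planeDet] <;> ring

lemma eq_add_of_planeDet_eq_one {v w : Fin 2 → ℝ} (h : planeDet v w = 1) (z : Fin 2 → ℝ) :
    z = planeDet z w • v + planeDet v z • w := by
  rw [← planeDet_smul_eq, h, one_smul]

lemma abs_planeDet_le (v w : Fin 2 → ℝ) : |planeDet v w| ≤ 2 * ‖v‖ * ‖w‖ := by
  have hprod (i j : Fin 2) : |v i * w j| ≤ ‖v‖ * ‖w‖ := by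
    rw [abs_mul]
    exact mul_le_mul (norm_le_pi_norm v i) (norm_le_pi_norm w j) (abs_nonneg _) (norm_nonneg _)
  calc |planeDet v w| ≤ |v 0 * w 1| + |v 1 * w 0| := abs_sub _ _
    _ ≤ 2 * ‖v‖ * ‖w‖ := by linarith [hprod 0 1, hprod 1 0]

@[fun_prop]
lemma continuous_planeDet {X : Type*} [TopologicalSpace X] {f g : X → Fin 2 → ℝ}
    (hf : Continuous f) (hg : Continuous g) : Continuous fun x => planeDet (f x) (g x) := by
  unfold planeDet
  fun_prop

@[fun_prop]
lemma continuous_matrix_smul {X : Type*} [TopologicalSpace X] {M : X → SL(2, ℝ)}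
    {f : X → Fin 2 → ℝ} (hM : Continuous M) (hf : Continuous f) :
    Continuous fun x => M x • f x :=
  (continuous_subtype_val.comp hM).matrix_mulVec hf

open scoped Matrix.Norms.Operator in
lemma exists_norm_smul_le {ι : Type*} [Finite ι] (A : ι → SL(2, ℝ)) :
    ∃ K : ℝ, 0 < K ∧ ∀ i (v : Fin 2 → ℝ), ‖A i • v‖ ≤ K * ‖v‖ := by
  obtain ⟨K, hK⟩ := (Set.finite_range fun i => ‖(A i : Matrix (Fin 2) (Fin 2) ℝ)‖).bddAbove
  refine ⟨max K 1, by positivity, fun i v => (linfty_opNorm_mulVec _ v).trans ?_⟩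
  gcongr
  exact (hK (Set.mem_range_self i)).trans (le_max_left _ _)

lemma cyclicallyOrdered_of_planeDet_pos {n : ℕ} {d : Fin n → Fin 2 → ℝ}
    (h : ∀ i j, i < j → 0 < planeDet (d i) (d j)) : CyclicallyOrdered d := fun i j k hij hjk =>
  mul_pos (mul_pos (h i j hij) (h j k hjk)) (h i k (hij.trans hjk))

end Plane

section Shift

/-- The shift homeomorphism of the space of bi-infinite sequences. -/
def shift {S : Type*} [TopologicalSpace S] : (ℤ → S) ≃ₜ (ℤ → S) where
  toFun x n := x (n + 1)
  invFun x n := x (n - 1)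
  left_inv x := by simp
  right_inv x := by simp

variable {S : Type*} [TopologicalSpace S] (x : ℤ → S) (n : ℕ) (k : ℤ)

@[simp]
lemma shift_apply : shift x k = x (k + 1) := rfl

@[simp]
lemma shift_symm_apply : shift.symm x k = x (k - 1) := rfl

lemma iterate_shift_apply : shift^[n] x k = x (k + n) := by
  induction n generalizing k with
  | zero => simp
  | succ n ih =>
    rw [Function.iterate_succ_apply', shift_apply, ih]
    congr 1
    push_cast
    ring

lemma iterate_shift_symm_apply : shift.symm^[n] x k = x (k - n) := by
  induction n generalizing k with
  | zero => simp
  | succ n ih =>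
    rw [Function.iterate_succ_apply', shift_symm_apply, ih]
    congr 1
    push_cast
    ring

end Shift

section Cocycle

variable {N : ℕ} (A : Fin N → SL(2, ℝ)) (x : ℤ → Fin N)

@[simp]
lemma forwardProduct_zero : forwardProduct A x 0 = 1 := rfl

lemma forwardProduct_succ (n : ℕ) :
    forwardProduct A x (n + 1) = A (x n) * forwardProduct A x n := rfl

lemma forwardProduct_add (n k : ℕ) :
    forwardProduct A x (n + k) = forwardProduct A (shift^[n] x) k * forwardProduct A x n := by
  induction k with
  | zero => simp
  | succ k ih =>
    rw [← add_assoc, forwardProduct_succ, ih, forwardProduct_succ, iterate_shift_apply, mul_assoc,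
      Nat.cast_add, add_comm (k : ℤ)]

lemma forwardProduct_succ' (n : ℕ) :
    forwardProduct A x (n + 1) = forwardProduct A (shift x) n * A (x 0) := by
  rw [add_comm, forwardProduct_add, forwardProduct_succ]
  simp

lemma backwardProduct_eq_inv (n : ℕ) :
    backwardProduct A x n = (forwardProduct A (shift.symm^[n] x) n)⁻¹ := by
  induction n with
  | zero => simp [backwardProduct]
  | succ n ih =>
    rw [forwardProduct_succ', _root_.mul_inv_rev, Function.iterate_succ_apply',
      shift.apply_symm_apply, ← ih, backwardProduct, shift_symm_apply, iterate_shift_symm_apply]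
    congr 3
    ring_nf

lemma continuous_forwardProduct (n : ℕ) : Continuous fun x => forwardProduct A x n := by
  induction n with
  | zero => exact continuous_const
  | succ n ih => exact (continuous_of_discreteTopology.comp (continuous_apply _)).mul ih

end Cocycle

/-! ### Hyperbolicity of a cocycle with an expanded vector -/

/-- The multiplicative analogue of `birkhoffSum`: the product of the values of `φ` along the first
`n` points of the orbit of `x` under `T`. -/
def birkhoffProd {X : Type*} (T : X → X) (φ : X → ℝ) (n : ℕ) (x : X) : ℝ :=
  ∏ j ∈ Finset.range n, φ (T^[j] x)

lemma birkhoffProd_succ {X : Type*} (T : X → X) (φ : X → ℝ) (n : ℕ) (x : X) :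
    birkhoffProd T φ (n + 1) x = birkhoffProd T φ n x * φ (T^[n] x) :=
  Finset.prod_range_succ _ _

section InvariantSections

variable {N : ℕ} {A : Fin N → SL(2, ℝ)} {e u : (ℤ → Fin N) → Fin 2 → ℝ} {χ : (ℤ → Fin N) → ℝ}

lemma forwardProduct_smul_of_section (he : ∀ x, A (x 0) • e x = χ x • e (shift x))
    (x : ℤ → Fin N) (n : ℕ) :
    forwardProduct A x n • e x = birkhoffProd shift χ n x • e (shift^[n] x) := by
  induction n with
  | zero => simp [birkhoffProd]
  | succ n ih =>
    have hn : A (x n) • e (shift^[n] x) = χ (shift^[n] x) • e (shift (shift^[n] x)) := by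
      simpa [iterate_shift_apply] using he (shift^[n] x)
    rw [forwardProduct_succ, mul_smul, ih, smul_comm, hn, smul_smul, birkhoffProd_succ,
      Function.iterate_succ_apply']

lemma section_iterate_shift (hu : ∀ x, u (shift x) = χ x • A (x 0) • u x)
    (x : ℤ → Fin N) (n : ℕ) :
    u (shift^[n] x) = birkhoffProd shift χ n x • forwardProduct A x n • u x := by
  induction n with
  | zero => simp [birkhoffProd]
  | succ n ih =>
    rw [Function.iterate_succ_apply', hu, ih, iterate_shift_apply, zero_add, smul_comm (A (x n)),
      ← mul_smul (A (x n)), ← forwardProduct_succ, smul_smul, birkhoffProd_succ, mul_comm]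

lemma backwardProduct_smul_of_section (hu : ∀ x, u (shift x) = χ x • A (x 0) • u x)
    (x : ℤ → Fin N) (n : ℕ) :
    backwardProduct A x n • u x
      = birkhoffProd shift χ n (shift.symm^[n] x) • u (shift.symm^[n] x) := by
  have h := section_iterate_shift hu (shift.symm^[n] x) n
  rw [Function.RightInverse.iterate shift.apply_symm_apply n x] at h
  rw [h, backwardProduct_eq_inv, smul_comm, inv_smul_smul]

lemma exists_norm_le_of_continuous {X E : Type*} [TopologicalSpace X] [CompactSpace X]
    [SeminormedAddGroup E] {f : X → E} (hf : Continuous f) : ∃ C : ℝ, 0 < C ∧ ∀ x, ‖f x‖ ≤ C := by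
  obtain ⟨C, hC⟩ := isCompact_univ.exists_bound_of_continuousOn hf.continuousOn
  exact ⟨max C 1, by positivity, fun x => (hC x trivial).trans (le_max_left _ _)⟩

/-- The linear projection onto the line of `e` along the line of `u`, when
`planeDet u e = 1`. -/
def projectionAlong (u e : Fin 2 → ℝ) : Matrix (Fin 2) (Fin 2) ℝ :=
  vecMulVec e ![-u 1, u 0]

lemma projectionAlong_mulVec (u e v : Fin 2 → ℝ) :
    projectionAlong u e *ᵥ v = planeDet u v • e := by
  ext i
  simp only [projectionAlong, vecMulVec_mulVec, vec2_dotProduct, planeDet, Pi.smul_apply,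
    MulOpposite.smul_eq_mul_unop, MulOpposite.unop_op, cons_val_zero, cons_val_one, smul_eq_mul]
  ring

lemma continuous_projectionAlong (hu : Continuous u) (he : Continuous e) :
    Continuous fun x => projectionAlong (u x) (e x) := by
  refine continuous_matrix fun i j => ?_
  fin_cases j <;> simp only [projectionAlong, vecMulVec_apply] <;> fun_prop

variable (he : ∀ x, A (x 0) • e x = χ x • e (shift x))
  (hu : ∀ x, u (shift x) = χ x • A (x 0) • u x) (hue : ∀ x, planeDet (u x) (e x) = 1)
include he hu

lemma projectionAlong_equivariant (x : ℤ → Fin N) (v : Fin 2 → ℝ) :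
    A (x 0) • planeDet (u x) v • e x
      = planeDet (u (shift x)) (A (x 0) • v) • e (shift x) := by
  rw [hu, planeDet_smul_left, planeDet_smul_smul, smul_comm, he, smul_smul, mul_comm]

include hue

/-- The normalisation `planeDet u e = 1` makes a single factor `χ` govern both line fields. -/
theorem uniformlyHyperbolic_of_sections (hec : Continuous e) (huc : Continuous u) {C r : ℝ}
    (hC : 0 < C) (hr0 : 0 < r) (hr1 : r < 1)
    (hχ : ∀ x n, |birkhoffProd shift χ n x| ≤ C * r ^ n) : UniformlyHyperbolic A := by
  obtain ⟨R, hR0, hR⟩ := exists_norm_le_of_continuous hec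
  obtain ⟨S, hS0, hS⟩ := exists_norm_le_of_continuous huc
  refine ⟨fun x => projectionAlong (u x) (e x), continuous_projectionAlong huc hec,
    fun x => mulVec_injective ?_, fun x => mulVec_injective ?_, 2 * R * S * C, r,
    by positivity, hr0, hr1, fun x n v hv => ?_, fun x n v hv => ?_⟩
  · funext v
    simp only [← mulVec_mulVec, projectionAlong_mulVec, planeDet_smul_right, hue, mul_one]
  · funext v
    simp only [← mulVec_mulVec, projectionAlong_mulVec, mulVec_eq_smul]
    exact projectionAlong_equivariant he hu x v
  · rw [projectionAlong_mulVec] at hv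
    calc ‖forwardProduct A x n • v‖
        = |planeDet (u x) v| * (|birkhoffProd shift χ n x| * ‖e (shift^[n] x)‖) := by
          nth_rw 1 [← hv]
          rw [smul_comm, forwardProduct_smul_of_section he, norm_smul, norm_smul,
            Real.norm_eq_abs, Real.norm_eq_abs]
      _ ≤ 2 * S * ‖v‖ * (C * r ^ n * R) := by
          gcongr
          exacts [(abs_planeDet_le _ _).trans (by gcongr; exact hS x), hχ x n, hR _]
      _ = 2 * R * S * C * r ^ n * ‖v‖ := by ring
  · rw [projectionAlong_mulVec] at hv
    have hvu : v = planeDet v (e x) • u x := by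
      simpa only [hv, add_zero] using eq_add_of_planeDet_eq_one (hue x) v
    calc ‖backwardProduct A x n • v‖
        = |planeDet v (e x)| * (|birkhoffProd shift χ n (shift.symm^[n] x)| *
            ‖u (shift.symm^[n] x)‖) := by
          nth_rw 1 [hvu]
          rw [smul_comm, backwardProduct_smul_of_section hu, norm_smul, norm_smul,
            Real.norm_eq_abs, Real.norm_eq_abs]
      _ ≤ 2 * ‖v‖ * R * (C * r ^ n * S) := by
          gcongr
          exacts [(abs_planeDet_le _ _).trans (by gcongr; exact hR x), hχ _ n, hS _]
      _ = 2 * R * S * C * r ^ n * ‖v‖ := by ring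

end InvariantSections

section OrthogonalProjection

/-- The coefficient of the orthogonal projection of `g` onto the line spanned by `f`. -/
noncomputable def projectionCoeff (f g : Fin 2 → ℝ) : ℝ := (f ⬝ᵥ g) / (f ⬝ᵥ f)

variable {f g : Fin 2 → ℝ}

lemma sq_norm_le_dotProduct_self (f : Fin 2 → ℝ) : ‖f‖ ^ 2 ≤ f ⬝ᵥ f := by
  have hff : 0 ≤ f ⬝ᵥ f := Finset.sum_nonneg fun i _ => mul_self_nonneg (f i)
  have hcoord : ‖f‖ ≤ √(f ⬝ᵥ f) := by
    refine (pi_norm_le_iff_of_nonneg (Real.sqrt_nonneg _)).2 fun i => Real.abs_le_sqrt ?_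
    rw [sq]
    exact Finset.single_le_sum (f := fun i => f i * f i) (fun i _ => mul_self_nonneg (f i))
      (Finset.mem_univ i)
  exact (Real.le_sqrt (norm_nonneg f) hff).1 hcoord

lemma norm_sub_projectionCoeff_smul_le (hfg : planeDet f g = 1) :
    ‖g - projectionCoeff f g • f‖ ≤ ‖f‖⁻¹ := by
  have hf : 0 < ‖f‖ := norm_pos_iff.2 fun h => by simp [h, planeDet] at hfg
  have hff : 0 < f ⬝ᵥ f := (pow_pos hf 2).trans_le (sq_norm_le_dotProduct_self f)
  have hrot : ‖![-f 1, f 0]‖ ≤ ‖f‖ := by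
    refine (pi_norm_le_iff_of_nonneg (norm_nonneg f)).2 fun i => ?_
    fin_cases i <;> simp [-Real.norm_eq_abs, norm_le_pi_norm]
  have hrej : g - projectionCoeff f g • f = (f ⬝ᵥ f)⁻¹ • ![-f 1, f 0] := by
    rw [eq_inv_smul_iff₀ hff.ne', smul_sub, smul_smul, projectionCoeff, mul_div_cancel₀ _ hff.ne']
    simp only [planeDet] at hfg
    ext i
    fin_cases i <;>
      simp only [vec2_dotProduct, Fin.zero_eta, Fin.mk_one, Pi.sub_apply, Pi.smul_apply,
        smul_eq_mul, cons_val_zero, cons_val_one]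
    · linear_combination -f 1 * hfg
    · linear_combination f 0 * hfg
  calc ‖g - projectionCoeff f g • f‖ = (f ⬝ᵥ f)⁻¹ * ‖![-f 1, f 0]‖ := by
        rw [hrej, norm_smul, norm_inv, Real.norm_of_nonneg hff.le]
    _ ≤ (‖f‖ ^ 2)⁻¹ * ‖f‖ := by
        gcongr
        exact sq_norm_le_dotProduct_self f
    _ = ‖f‖⁻¹ := by field_simp

lemma abs_projectionCoeff_sub_mul_norm_le {M : SL(2, ℝ)} {K : ℝ}
    (hM : ∀ z : Fin 2 → ℝ, ‖M • z‖ ≤ K * ‖z‖) (hK : 0 ≤ K) (hfg : planeDet f g = 1) :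
    |projectionCoeff (M • f) (M • g) - projectionCoeff f g| * ‖M • f‖
      ≤ K * ‖f‖⁻¹ + ‖M • f‖⁻¹ := by
  set α := projectionCoeff f g
  set α' := projectionCoeff (M • f) (M • g)
  have hdiff : (α' - α) • (M • f) = M • (g - α • f) - (M • g - α' • (M • f)) := by
    rw [smul_sub, smul_comm M α, sub_smul]
    abel
  calc |α' - α| * ‖M • f‖ = ‖M • (g - α • f) - (M • g - α' • (M • f))‖ := by
        rw [← hdiff, norm_smul (α' - α), Real.norm_eq_abs]
    _ ≤ ‖M • (g - α • f)‖ + ‖M • g - α' • (M • f)‖ := norm_sub_le _ _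
    _ ≤ K * ‖f‖⁻¹ + ‖M • f‖⁻¹ := by
        refine add_le_add ((hM _).trans ?_) ?_
        · gcongr
          exact norm_sub_projectionCoeff_smul_le hfg
        · exact norm_sub_projectionCoeff_smul_le (by rwa [planeDet_smul_smul])

lemma continuous_projectionCoeff {X : Type*} [TopologicalSpace X] {f g : X → Fin 2 → ℝ}
    (hf : Continuous f) (hg : Continuous g) (hf0 : ∀ x, f x ≠ 0) :
    Continuous fun x => projectionCoeff (f x) (g x) :=
  (hf.dotProduct hg).div (hf.dotProduct hf) fun x => dotProduct_self_eq_zero.not.2 (hf0 x)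

lemma exists_planeDet_eq_one {v : Fin 2 → ℝ} (hv : v ≠ 0) : ∃ w, planeDet v w = 1 := by
  refine ⟨(v ⬝ᵥ v)⁻¹ • ![-v 1, v 0], ?_⟩
  have hvv : v ⬝ᵥ v ≠ 0 := dotProduct_self_eq_zero.not.2 hv
  rw [planeDet_smul_right, inv_mul_eq_one₀ hvv, vec2_dotProduct]
  simp only [planeDet, cons_val_zero, cons_val_one]
  ring

end OrthogonalProjection

/-- The vector `v` is exponentially expanded along every orbit of the cocycle, between any two
times: the dominated growth that makes the line of `v` transverse to a stable line field. -/
def UniformlyExpands {N : ℕ} (A : Fin N → SL(2, ℝ)) (v : Fin 2 → ℝ) : Prop :=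
  v ≠ 0 ∧ ∃ c θ : ℝ, 0 < c ∧ 1 < θ ∧ ∀ x n k,
    c * θ ^ k * ‖forwardProduct A x n • v‖ ≤ ‖forwardProduct A x (n + k) • v‖

section StableSection

variable {N : ℕ} {A : Fin N → SL(2, ℝ)} {v w : Fin 2 → ℝ}

/-- The coefficient `α` for which `w - α • v` is contracted most by `A^n(x)`, up to a bounded
factor. -/
noncomputable def finiteTimeCoeff (A : Fin N → SL(2, ℝ)) (v w : Fin 2 → ℝ) (x : ℤ → Fin N)
    (n : ℕ) : ℝ :=
  projectionCoeff (forwardProduct A x n • v) (forwardProduct A x n • w)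

lemma continuous_finiteTimeCoeff (hv : v ≠ 0) (n : ℕ) :
    Continuous fun x => finiteTimeCoeff A v w x n := by
  have hn := continuous_forwardProduct A n
  exact continuous_projectionCoeff (by fun_prop) (by fun_prop) fun x =>
    (smul_ne_zero_iff_ne _).2 hv

lemma norm_forwardProduct_smul_pos (hv : v ≠ 0) (x : ℤ → Fin N) (n : ℕ) :
    0 < ‖forwardProduct A x n • v‖ :=
  norm_pos_iff.2 ((smul_ne_zero_iff_ne _).2 hv)

variable {c θ : ℝ} (hv : v ≠ 0) (hc : 0 < c) (hθ : 1 < θ)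
  (hexp : ∀ x n k, c * θ ^ k * ‖forwardProduct A x n • v‖ ≤ ‖forwardProduct A x (n + k) • v‖)
  (hvw : planeDet v w = 1)
include hv hc hθ hexp hvw

lemma exists_dist_finiteTimeCoeff_le : ∃ L, ∀ x n k,
    dist (finiteTimeCoeff A v w x (n + k)) (finiteTimeCoeff A v w x (n + k + 1))
      ≤ L * (‖forwardProduct A x n • v‖ ^ 2)⁻¹ * ((θ ^ 2)⁻¹) ^ k := by
  obtain ⟨K, hK0, hK⟩ := exists_norm_smul_le A
  refine ⟨(K / c + 1 / c ^ 2) / c ^ 2, fun x n k => ?_⟩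
  set a := ‖forwardProduct A x n • v‖
  set f := ‖forwardProduct A x (n + k) • v‖
  set f' := ‖forwardProduct A x (n + k + 1) • v‖
  have ha : 0 < a := norm_forwardProduct_smul_pos hv x n
  have hf : 0 < f := norm_forwardProduct_smul_pos hv x (n + k)
  have hgrow : c * f ≤ f' := by
    refine le_trans ?_ (hexp x (n + k) 1)
    gcongr
    nlinarith
  have hf' : 0 < f' := (mul_pos hc hf).trans_le hgrow
  have hstep : dist (finiteTimeCoeff A v w x (n + k)) (finiteTimeCoeff A v w x (n + k + 1)) * f'
      ≤ K * f⁻¹ + f'⁻¹ := by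
    rw [dist_comm, Real.dist_eq]
    have h := abs_projectionCoeff_sub_mul_norm_le (hK (x (n + k : ℕ))) hK0.le
      ((planeDet_smul_smul (forwardProduct A x (n + k)) v w).trans hvw)
    rwa [← mul_smul, ← mul_smul, ← forwardProduct_succ] at h
  calc dist (finiteTimeCoeff A v w x (n + k)) (finiteTimeCoeff A v w x (n + k + 1))
      ≤ (K * f⁻¹ + f'⁻¹) / f' := (le_div_iff₀ hf').2 hstep
    _ ≤ (K * f⁻¹ + (c * f)⁻¹) / (c * f) := by gcongr
    _ = (K / c + 1 / c ^ 2) * (f ^ 2)⁻¹ := by field_simp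
    _ ≤ (K / c + 1 / c ^ 2) * ((c * θ ^ k * a) ^ 2)⁻¹ := by
        gcongr
        exact hexp x n k
    _ = (K / c + 1 / c ^ 2) / c ^ 2 * (a ^ 2)⁻¹ * ((θ ^ 2)⁻¹) ^ k := by
        rw [inv_pow, ← pow_mul, mul_comm 2 k, pow_mul]
        field_simp

lemma exists_stableCoeff : ∃ α : (ℤ → Fin N) → ℝ, Continuous α ∧ ∃ L, ∀ x n,
    dist (finiteTimeCoeff A v w x n) (α x) ≤ L * (‖forwardProduct A x n • v‖ ^ 2)⁻¹ := by
  obtain ⟨L, hL⟩ := exists_dist_finiteTimeCoeff_le hv hc hθ hexp hvw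
  set ρ := (θ ^ 2)⁻¹
  have hρ0 : 0 ≤ ρ := by positivity
  have hρ1 : ρ < 1 := inv_lt_one_of_one_lt₀ (one_lt_pow₀ hθ two_ne_zero)
  have hL0 : ∀ x k, dist (finiteTimeCoeff A v w x k) (finiteTimeCoeff A v w x (k + 1))
      ≤ L * (‖v‖ ^ 2)⁻¹ * ρ ^ k := fun x k => by
    simpa only [forwardProduct_zero, one_smul, zero_add] using hL x 0 k
  choose α hα using fun x => cauchySeq_tendsto_of_complete
    (cauchySeq_of_le_geometric ρ _ hρ1 (hL0 x))
  have huniform : TendstoUniformly (fun n x => finiteTimeCoeff A v w x n) α atTop := by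
    have hgeom : Tendsto (fun n => L * (‖v‖ ^ 2)⁻¹ * ρ ^ n / (1 - ρ)) atTop (𝓝 0) := by
      simpa using ((tendsto_pow_atTop_nhds_zero_of_lt_one hρ0 hρ1).const_mul
        (L * (‖v‖ ^ 2)⁻¹)).div_const (1 - ρ)
    refine Metric.tendstoUniformly_iff.2 fun ε hε => ?_
    filter_upwards [hgeom.eventually_lt_const hε] with n hn x
    rw [dist_comm]
    exact (dist_le_of_le_geometric_of_tendsto ρ _ hρ1 (hL0 x) (hα x) n).trans_lt hn
  refine ⟨α, huniform.continuous (Frequently.of_forall (continuous_finiteTimeCoeff hv)),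
    L / (1 - ρ), fun x n => ?_⟩
  have htail : Tendsto (fun k => finiteTimeCoeff A v w x (n + k)) atTop (𝓝 (α x)) := by
    simpa only [add_comm] using (tendsto_add_atTop_iff_nat n).2 (hα x)
  refine (dist_le_of_le_geometric_of_tendsto₀ ρ _ hρ1 (hL x n) htail).trans_eq ?_
  ring

end StableSection

lemma UniformlyExpands.exists_contracted_section {N : ℕ} {A : Fin N → SL(2, ℝ)} {v : Fin 2 → ℝ}
    (h : UniformlyExpands A v) : ∃ e : (ℤ → Fin N) → Fin 2 → ℝ, Continuous e ∧
      (∀ x, planeDet v (e x) = 1) ∧ ∃ C r : ℝ, 0 < C ∧ 0 < r ∧ r < 1 ∧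
        ∀ x n, ‖forwardProduct A x n • e x‖ ≤ C * r ^ n := by
  obtain ⟨hv, c, θ, hc, hθ, hexp⟩ := h
  obtain ⟨w, hvw⟩ := exists_planeDet_eq_one hv
  obtain ⟨α, hα, L, hL⟩ := exists_stableCoeff hv hc hθ hexp hvw
  have : 0 < ‖v‖ := norm_pos_iff.2 hv
  refine ⟨fun x => w - α x • v, by fun_prop, fun x => by simp [hvw],
    (1 + |L|) * (c * ‖v‖)⁻¹, θ⁻¹, by positivity, by positivity, inv_lt_one_of_one_lt₀ hθ,
    fun x n => ?_⟩
  set a := finiteTimeCoeff A v w x n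
  set f := forwardProduct A x n • v
  set g := forwardProduct A x n • w
  have hf0 : 0 < ‖f‖ := norm_forwardProduct_smul_pos hv x n
  have hsplit : forwardProduct A x n • (w - α x • v) = (g - a • f) + (a - α x) • f := by
    rw [smul_sub, smul_comm, sub_smul]
    abel
  calc ‖forwardProduct A x n • (w - α x • v)‖
      ≤ ‖g - a • f‖ + |a - α x| * ‖f‖ := by
        rw [hsplit, ← Real.norm_eq_abs, ← norm_smul (a - α x)]
        exact norm_add_le _ _
    _ ≤ ‖f‖⁻¹ + |L| * (‖f‖ ^ 2)⁻¹ * ‖f‖ := by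
        gcongr
        · exact norm_sub_projectionCoeff_smul_le ((planeDet_smul_smul _ v w).trans hvw)
        · exact (hL x n).trans (by gcongr; exact le_abs_self L)
    _ = (1 + |L|) * ‖f‖⁻¹ := by field_simp
    _ ≤ (1 + |L|) * (c * θ ^ n * ‖v‖)⁻¹ := by
        gcongr
        simpa only [forwardProduct_zero, one_smul, zero_add] using hexp x 0 n
    _ = (1 + |L|) * (c * ‖v‖)⁻¹ * θ⁻¹ ^ n := by
        rw [inv_pow]
        field_simp

lemma continuous_birkhoffProd {X : Type*} [TopologicalSpace X] {T : X → X} {φ : X → ℝ}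
    (hT : Continuous T) (hφ : Continuous φ) (n : ℕ) : Continuous (birkhoffProd T φ n) :=
  continuous_finsetProd _ fun j _ => hφ.comp (hT.iterate j)

lemma exists_continuous_cohomological_solution {X : Type*} [TopologicalSpace X] [CompactSpace X]
    (T : X ≃ₜ X) {φ F : X → ℝ} (hφ : Continuous φ) (hF : Continuous F) {C r : ℝ} (hC : 0 ≤ C)
    (hr0 : 0 ≤ r) (hr1 : r < 1) (hbound : ∀ x n, |birkhoffProd T φ n x| ≤ C * r ^ n) :
    ∃ β : X → ℝ, Continuous β ∧ ∀ x, β (T x) = F x + φ x * β x := by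
  obtain ⟨B, -, hB⟩ := exists_norm_le_of_continuous hF
  let term (n : ℕ) (x : X) : ℝ := birkhoffProd T φ n (T.symm^[n] x) * F (T.symm^[n + 1] x)
  have hterm_cont (n : ℕ) : Continuous (term n) :=
    ((continuous_birkhoffProd T.continuous hφ n).comp (T.symm.continuous.iterate n)).mul
      (hF.comp (T.symm.continuous.iterate (n + 1)))
  have hmajorant : Summable fun n => C * r ^ n * B :=
    ((summable_geometric_of_lt_one hr0 hr1).mul_left C).mul_right B
  have hterm_le (n : ℕ) (x : X) : ‖term n x‖ ≤ C * r ^ n * B := by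
    rw [norm_mul]
    exact mul_le_mul (hbound _ n) (hB _) (norm_nonneg _) (by positivity)
  have hterm_zero (x : X) : term 0 (T x) = F x := by simp [term, birkhoffProd]
  have hterm_succ (n : ℕ) (x : X) : term (n + 1) (T x) = φ x * term n x := by
    simp only [term]
    rw [Function.iterate_succ_apply (n := n), T.symm_apply_apply, birkhoffProd_succ,
      Function.RightInverse.iterate T.apply_symm_apply n x,
      Function.iterate_succ_apply (n := n + 1), T.symm_apply_apply]
    ring
  refine ⟨fun x => ∑' n, term n x, continuous_tsum hterm_cont hmajorant hterm_le, fun x => ?_⟩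
  beta_reduce
  have hsummable := Summable.of_norm_bounded hmajorant fun n => hterm_le n (T x)
  rw [hsummable.tsum_eq_zero_add, hterm_zero]
  simp only [hterm_succ, tsum_mul_left]

section ContractedSection

variable {N : ℕ} {A : Fin N → SL(2, ℝ)} {v : Fin 2 → ℝ} {e : (ℤ → Fin N) → Fin 2 → ℝ} {C r : ℝ}
  (h : UniformlyExpands A v) (hve : ∀ x, planeDet v (e x) = 1) (hC : 0 < C) (hr0 : 0 < r)
  (hr1 : r < 1) (he : ∀ x n, ‖forwardProduct A x n • e x‖ ≤ C * r ^ n)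
include h hve hC hr0 hr1 he

lemma eq_smul_section_of_forward_bounded {x : ℤ → Fin N} {z : Fin 2 → ℝ} {B : ℝ}
    (hz : ∀ n, ‖forwardProduct A x n • z‖ ≤ B) : z = planeDet v z • e x := by
  obtain ⟨hv, c, θ, hc, hθ, hexp⟩ := h
  have hdecomp := eq_add_of_planeDet_eq_one (hve x) z
  set p := planeDet z (e x)
  set q := planeDet v z
  suffices hp : p = 0 by rwa [hp, zero_smul, zero_add] at hdecomp
  by_contra hp
  have hbound (n : ℕ) : |p| * (c * ‖v‖) * θ ^ n ≤ B + |q| * C := by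
    have hpv : p • forwardProduct A x n • v
        = forwardProduct A x n • z - q • forwardProduct A x n • e x := by
      rw [eq_sub_iff_add_eq, ← smul_comm _ p, ← smul_comm _ q, ← smul_add, ← hdecomp]
    have hgrow : c * θ ^ n * ‖v‖ ≤ ‖forwardProduct A x n • v‖ := by
      simpa only [forwardProduct_zero, one_smul, zero_add] using hexp x 0 n
    calc |p| * (c * ‖v‖) * θ ^ n = |p| * (c * θ ^ n * ‖v‖) := by ring
      _ ≤ |p| * ‖forwardProduct A x n • v‖ := by gcongr
      _ = ‖forwardProduct A x n • z - q • forwardProduct A x n • e x‖ := by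
        rw [← hpv, norm_smul p, Real.norm_eq_abs]
      _ ≤ ‖forwardProduct A x n • z‖ + |q| * ‖forwardProduct A x n • e x‖ := by
        rw [← Real.norm_eq_abs q, ← norm_smul q]
        exact norm_sub_le _ _
      _ ≤ B + |q| * C := by
        gcongr
        · exact hz n
        · exact (he x n).trans (mul_le_of_le_one_right hC.le (pow_le_one₀ hr0.le hr1.le))
  have hcoeff : 0 < |p| * (c * ‖v‖) := by positivity
  obtain ⟨n, hn⟩ := pow_unbounded_of_one_lt ((B + |q| * C) / (|p| * (c * ‖v‖))) hθ
  rw [div_lt_iff₀' hcoeff] at hn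
  exact (hbound n).not_gt hn

lemma exists_multiplier (hec : Continuous e) : ∃ χ : (ℤ → Fin N) → ℝ, Continuous χ ∧
    ∀ x, A (x 0) • e x = χ x • e (shift x) := by
  have : Continuous fun x : ℤ → Fin N => A (x 0) :=
    continuous_of_discreteTopology.comp (continuous_apply 0)
  refine ⟨fun x => planeDet v (A (x 0) • e x), by fun_prop, fun x =>
    eq_smul_section_of_forward_bounded h hve hC hr0 hr1 he (B := C) fun n => ?_⟩
  rw [← mul_smul, ← forwardProduct_succ']
  exact (he x (n + 1)).trans (mul_le_of_le_one_right hC.le (pow_le_one₀ hr0.le hr1.le))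

end ContractedSection

theorem UniformlyExpands.uniformlyHyperbolic {N : ℕ} {A : Fin N → SL(2, ℝ)} {v : Fin 2 → ℝ}
    (h : UniformlyExpands A v) : UniformlyHyperbolic A := by
  obtain ⟨e, hec, hve, C, r, hC, hr0, hr1, he⟩ := h.exists_contracted_section
  obtain ⟨χ, hχc, hinv⟩ := exists_multiplier h hve hC hr0 hr1 he hec
  have : Continuous fun x : ℤ → Fin N => A (x 0) :=
    continuous_of_discreteTopology.comp (continuous_apply 0)
  have hv : 0 < ‖v‖ := norm_pos_iff.2 h.1
  have hχ (x n) : |birkhoffProd shift χ n x| ≤ 2 * ‖v‖ * C * r ^ n := by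
    have hcoord : birkhoffProd shift χ n x = planeDet v (forwardProduct A x n • e x) := by
      rw [forwardProduct_smul_of_section hinv, planeDet_smul_right, hve, mul_one]
    rw [hcoord, mul_assoc]
    exact (abs_planeDet_le _ _).trans (by gcongr; exact he x n)
  have hχsq (x n) :
      |birkhoffProd shift (fun y => χ y ^ 2) n x| ≤ (2 * ‖v‖ * C) ^ 2 * (r ^ 2) ^ n := by
    rw [birkhoffProd, Finset.prod_pow, abs_pow, ← pow_mul, mul_comm 2 n, pow_mul, ← mul_pow]
    gcongr
    exact hχ x n
  obtain ⟨β, hβ, hβ_shift⟩ := exists_continuous_cohomological_solution shift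
    (φ := fun x => χ x ^ 2) (F := fun x => χ x * planeDet v (A (x 0) • v)) (by fun_prop)
    (by fun_prop) (by positivity) (by positivity) (pow_lt_one₀ hr0.le hr1 two_ne_zero) hχsq
  refine uniformlyHyperbolic_of_sections (u := fun x => v + β x • e x) hinv (fun x => ?_)
    (fun x => by simp [hve]) hec (by fun_prop) (by positivity) hr0 hr1 hχ
  have hdecomp := eq_add_of_planeDet_eq_one (hve (shift x)) (A (x 0) • v)
  have hdet : χ x * planeDet (A (x 0) • v) (e (shift x)) = 1 := by
    rw [← planeDet_smul_right, ← hinv, planeDet_smul_smul, hve]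
  rw [smul_add, smul_comm (A (x 0)), hinv, hdecomp, hβ_shift]
  match_scalars
  · linear_combination -hdet
  · ring

/-! ### The cone criterion -/

section Homogeneous

variable {E : Type*} [NormedAddCommGroup E] [NormedSpace ℝ E] {q : E → ℝ}

lemma eq_sq_norm_mul_of_homogeneous (hhom : ∀ (c : ℝ) v, q (c • v) = c ^ 2 * q v) {v : E}
    (hv : v ≠ 0) : q v = ‖v‖ ^ 2 * q (‖v‖⁻¹ • v) := by
  rw [← hhom, smul_inv_smul₀ (norm_ne_zero_iff.2 hv)]

lemma inv_norm_smul_mem_sphere {v : E} (hv : v ≠ 0) : ‖v‖⁻¹ • v ∈ Metric.sphere (0 : E) 1 := by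
  rw [mem_sphere_zero_iff_norm, norm_smul, norm_inv, norm_norm,
    inv_mul_cancel₀ (norm_ne_zero_iff.2 hv)]

variable [ProperSpace E]

lemma exists_mul_sq_norm_le_of_homogeneous (hq : Continuous q)
    (hhom : ∀ (c : ℝ) v, q (c • v) = c ^ 2 * q v) (hpos : ∀ v ≠ 0, 0 < q v) :
    ∃ δ > 0, ∀ v, δ * ‖v‖ ^ 2 ≤ q v := by
  obtain ⟨δ, hδ, hsphere⟩ := (isCompact_sphere (0 : E) 1).exists_forall_le' hq.continuousOn
    fun v hv => hpos v (ne_zero_of_mem_unit_sphere ⟨v, hv⟩)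
  refine ⟨δ, hδ, fun v => ?_⟩
  rcases eq_or_ne v 0 with rfl | hv
  · simpa using (hhom 0 0).ge
  · rw [eq_sq_norm_mul_of_homogeneous hhom hv, mul_comm]
    gcongr
    exact hsphere _ (inv_norm_smul_mem_sphere hv)

lemma exists_le_mul_sq_norm_of_homogeneous (hq : Continuous q)
    (hhom : ∀ (c : ℝ) v, q (c • v) = c ^ 2 * q v) : ∃ R, ∀ v, q v ≤ R * ‖v‖ ^ 2 := by
  obtain ⟨R, hR⟩ := (isCompact_sphere (0 : E) 1).bddAbove_image hq.continuousOn
  refine ⟨R, fun v => ?_⟩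
  rcases eq_or_ne v 0 with rfl | hv
  · simpa using (hhom 0 0).le
  · rw [eq_sq_norm_mul_of_homogeneous hhom hv, mul_comm]
    gcongr
    exact hR (Set.mem_image_of_mem q (inv_norm_smul_mem_sphere hv))

end Homogeneous

section QuadraticFamily

variable {N : ℕ} {A : Fin N → SL(2, ℝ)} {𝒬 : Set ((Fin 2 → ℝ) → ℝ)}

lemma exists_uniform_increment (hfin : 𝒬.Finite) (hcont : ∀ q ∈ 𝒬, Continuous q)
    (hhom : ∀ q ∈ 𝒬, ∀ (c : ℝ) v, q (c • v) = c ^ 2 * q v)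
    (hinc : ∀ q ∈ 𝒬, ∀ i, ∃ q' ∈ 𝒬, ∀ v ≠ 0, q v < q' (A i • v)) :
    ∃ δ > 0, ∀ q ∈ 𝒬, ∀ i, ∃ q' ∈ 𝒬, ∀ v, q v + δ * ‖v‖ ^ 2 ≤ q' (A i • v) := by
  have hevent : ∀ᶠ δ in 𝓝[>] (0 : ℝ),
      ∀ q ∈ 𝒬, ∀ i, ∃ q' ∈ 𝒬, ∀ v, q v + δ * ‖v‖ ^ 2 ≤ q' (A i • v) := by
    refine hfin.eventually_all.2 fun q hq => eventually_all.2 fun i => ?_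
    obtain ⟨q', hq', hlt⟩ := hinc q hq i
    have hq_cont := hcont q hq
    have hq'_cont := hcont q' hq'
    obtain ⟨ε, hε, hle⟩ := exists_mul_sq_norm_le_of_homogeneous
      (q := fun v => q' (A i • v) - q v) (by fun_prop)
      (fun c v => by rw [smul_comm, hhom q' hq', hhom q hq, mul_sub])
      (fun v hv => sub_pos.2 (hlt v hv))
    filter_upwards [Ioo_mem_nhdsGT hε] with δ hδ
    refine ⟨q', hq', fun v => ?_⟩
    have : δ * ‖v‖ ^ 2 ≤ ε * ‖v‖ ^ 2 := by gcongr; exact hδ.2.le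
    linarith [hle v]
  obtain ⟨δ, hδ, hδ_pos⟩ := (hevent.and self_mem_nhdsWithin).exists
  exact ⟨δ, hδ_pos, hδ⟩

lemma exists_uniform_upper_bound (hfin : 𝒬.Finite) (hcont : ∀ q ∈ 𝒬, Continuous q)
    (hhom : ∀ q ∈ 𝒬, ∀ (c : ℝ) v, q (c • v) = c ^ 2 * q v) :
    ∃ R > 0, ∀ q ∈ 𝒬, ∀ v, q v ≤ R * ‖v‖ ^ 2 := by
  have hevent : ∀ᶠ R in atTop, ∀ q ∈ 𝒬, ∀ v, q v ≤ R * ‖v‖ ^ 2 := by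
    refine hfin.eventually_all.2 fun q hq => ?_
    obtain ⟨S, hS⟩ := exists_le_mul_sq_norm_of_homogeneous (hcont q hq) (hhom q hq)
    filter_upwards [eventually_ge_atTop S] with R hR v
    exact (hS v).trans (by gcongr)
  obtain ⟨R, hR, hR_pos⟩ := (hevent.and (eventually_gt_atTop 0)).exists
  exact ⟨R, hR_pos, hR⟩

lemma exists_geometric_growth {δ R K η : ℝ} (hδ : 0 < δ) (hR : 0 < R) (hη0 : 0 < η)
    (hη : η * K ^ 2 ≤ δ) (hnorm : ∀ i (v : Fin 2 → ℝ), ‖A i • v‖ ≤ K * ‖v‖)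
    (hupper : ∀ q ∈ 𝒬, ∀ v, q v ≤ R * ‖v‖ ^ 2)
    (hinc : ∀ q ∈ 𝒬, ∀ i, ∃ q' ∈ 𝒬, ∀ v, q v + δ * ‖v‖ ^ 2 ≤ q' (A i • v))
    {q : (Fin 2 → ℝ) → ℝ} (hq : q ∈ 𝒬) {v : Fin 2 → ℝ} (hv : η * ‖v‖ ^ 2 ≤ q v)
    (x : ℤ → Fin N) (n : ℕ) :
    ∃ q' ∈ 𝒬, (1 + δ / R) ^ n * q v ≤ q' (forwardProduct A x n • v) ∧
      η * ‖forwardProduct A x n • v‖ ^ 2 ≤ q' (forwardProduct A x n • v) := by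
  induction n with
  | zero => exact ⟨q, hq, by simp, by simpa using hv⟩
  | succ n ih =>
    obtain ⟨q₁, hq₁, hgrowth, hcone⟩ := ih
    obtain ⟨q₂, hq₂, hstep⟩ := hinc q₁ hq₁ (x n)
    refine ⟨q₂, hq₂, ?_⟩
    rw [forwardProduct_succ, mul_smul]
    set z := forwardProduct A x n • v
    have hz : 0 ≤ q₁ z := le_trans (by positivity) hcone
    constructor
    · calc (1 + δ / R) ^ (n + 1) * q v ≤ (1 + δ / R) * q₁ z := by
            rw [pow_succ', mul_assoc]
            gcongr
        _ = q₁ z + δ / R * q₁ z := by ring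
        _ ≤ q₁ z + δ / R * (R * ‖z‖ ^ 2) := by
            gcongr
            exact hupper q₁ hq₁ z
        _ = q₁ z + δ * ‖z‖ ^ 2 := by field_simp
        _ ≤ q₂ (A (x n) • z) := hstep z
    · calc η * ‖A (x n) • z‖ ^ 2 ≤ η * (K * ‖z‖) ^ 2 := by
            gcongr
            exact hnorm _ z
        _ = η * K ^ 2 * ‖z‖ ^ 2 := by ring
        _ ≤ q₁ z + δ * ‖z‖ ^ 2 := by nlinarith [sq_nonneg ‖z‖]
        _ ≤ q₂ (A (x n) • z) := hstep z

/-- A finite-state version of Lewowicz's criterion. -/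
theorem uniformlyHyperbolic_of_quadratic_family (hfin : 𝒬.Finite)
    (hcont : ∀ q ∈ 𝒬, Continuous q) (hhom : ∀ q ∈ 𝒬, ∀ (c : ℝ) v, q (c • v) = c ^ 2 * q v)
    (hinc : ∀ q ∈ 𝒬, ∀ i, ∃ q' ∈ 𝒬, ∀ v ≠ 0, q v < q' (A i • v))
    (hpos : ∃ q ∈ 𝒬, ∃ v, 0 < q v) : UniformlyHyperbolic A := by
  obtain ⟨q, hq, v, hqv⟩ := hpos
  obtain ⟨δ, hδ, hδ_inc⟩ := exists_uniform_increment hfin hcont hhom hinc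
  obtain ⟨R, hR, hupper⟩ := exists_uniform_upper_bound hfin hcont hhom
  obtain ⟨K, hK, hnorm⟩ := exists_norm_smul_le A
  have hv : 0 < ‖v‖ := norm_pos_iff.2 (by
    rintro rfl
    simpa using hqv.trans_le (hupper q hq 0))
  set η := min (δ / K ^ 2) (q v / ‖v‖ ^ 2)
  have hη0 : 0 < η := by positivity
  have hηK : η * K ^ 2 ≤ δ := (le_div_iff₀ (by positivity)).1 (min_le_left _ _)
  have hηv : η * ‖v‖ ^ 2 ≤ q v := (le_div_iff₀ (by positivity)).1 (min_le_right _ _)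
  have hgrowth {q} (hq : q ∈ 𝒬) {z : Fin 2 → ℝ} (hz : η * ‖z‖ ^ 2 ≤ q z) :=
    exists_geometric_growth hδ hR hη0 hηK hnorm hupper hδ_inc hq hz
  suffices UniformlyExpands A v from this.uniformlyHyperbolic
  refine ⟨norm_pos_iff.1 hv, √(η / R), √(1 + δ / R), by positivity,
    Real.lt_sqrt_of_sq_lt (by simp only [one_pow, lt_add_iff_pos_right]; positivity),
    fun x n k => ?_⟩
  obtain ⟨q₁, hq₁, -, hcone⟩ := hgrowth hq hηv x n
  obtain ⟨q₂, hq₂, hexp, -⟩ := hgrowth hq₁ hcone (shift^[n] x) k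
  rw [← mul_smul, ← forwardProduct_add] at hexp
  refine (sq_le_sq₀ (by positivity) (norm_nonneg _)).1 ?_
  calc (√(η / R) * √(1 + δ / R) ^ k * ‖forwardProduct A x n • v‖) ^ 2
      = (1 + δ / R) ^ k * (η * ‖forwardProduct A x n • v‖ ^ 2) / R := by
        rw [mul_pow, mul_pow, ← pow_mul, mul_comm k 2, pow_mul, Real.sq_sqrt (by positivity),
          Real.sq_sqrt (by positivity)]
        ring
    _ ≤ (1 + δ / R) ^ k * q₁ (forwardProduct A x n • v) / R := by gcongr
    _ ≤ R * ‖forwardProduct A x (n + k) • v‖ ^ 2 / R :=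
        div_le_div_of_nonneg_right (hexp.trans (hupper q₂ hq₂ _)) hR.le
    _ = ‖forwardProduct A x (n + k) • v‖ ^ 2 := mul_div_cancel_left₀ _ hR.ne'

end QuadraticFamily

lemma mul_quadratic_pos {a b c x y : ℝ} (hdisc : b ^ 2 < a * c) (hxy : x ≠ 0 ∨ y ≠ 0) :
    0 < a * (a * x ^ 2 + 2 * b * x * y + c * y ^ 2) := by
  have hsquare : a * (a * x ^ 2 + 2 * b * x * y + c * y ^ 2)
      = (a * x + b * y) ^ 2 + (a * c - b ^ 2) * y ^ 2 := by ring
  have ha : a ≠ 0 := by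
    rintro rfl
    nlinarith [sq_nonneg b]
  rw [hsquare]
  rcases eq_or_ne y 0 with rfl | hy
  · have hx : x ≠ 0 := hxy.resolve_right (not_not.2 rfl)
    simp only [mul_zero, add_zero, ne_eq, OfNat.ofNat_ne_zero, not_false_eq_true, zero_pow]
    positivity
  · have := sub_pos.2 hdisc
    positivity

/-- A closed convex cone in the plane, given by vectors on its two sides; it is the set of the
vectors met when turning counterclockwise from `left` to `right` if `0 < planeDet left right`. -/
structure PlaneCone where
  left : Fin 2 → ℝ
  right : Fin 2 → ℝ

namespace PlaneCone

/-- The cone spanned by `left` and `right` is nondegenerate and counterclockwise. -/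
def Proper (c : PlaneCone) : Prop := 0 < planeDet c.left c.right

/-- The vectors in the closed cone. -/
def carrier (c : PlaneCone) : Set (Fin 2 → ℝ) :=
  {v | 0 ≤ planeDet c.left v ∧ 0 ≤ planeDet v c.right}

/-- The vectors in the open cone. -/
def interior (c : PlaneCone) : Set (Fin 2 → ℝ) :=
  {v | 0 < planeDet c.left v ∧ 0 < planeDet v c.right}

/-- `M` maps the nonzero vectors of the first cone, if it is proper, to the interior of the
second one. -/
def MapsInside (M : SL(2, ℝ)) (c d : PlaneCone) : Prop :=
  M • c.left ∈ d.interior ∧ M • c.right ∈ d.interior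

/-- The quadratic form which is positive on the interior of `c ∪ -c`, zero on the sides and
negative elsewhere, normalised so as to be invariant under the action of `SL(2, ℝ)` on cones. -/
noncomputable def form (c : PlaneCone) (v : Fin 2 → ℝ) : ℝ :=
  planeDet c.left v * planeDet v c.right / planeDet c.left c.right

variable {c d c' : PlaneCone} {M : SL(2, ℝ)} {v : Fin 2 → ℝ}

lemma continuous_form (c : PlaneCone) : Continuous c.form := by
  unfold form
  fun_prop

lemma form_smul (c : PlaneCone) (a : ℝ) (v : Fin 2 → ℝ) : c.form (a • v) = a ^ 2 * c.form v := by
  simp only [form, planeDet_smul_left, planeDet_smul_right]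
  ring

lemma form_neg (c : PlaneCone) (v : Fin 2 → ℝ) : c.form (-v) = c.form v := by
  simp only [form, planeDet_neg_left, planeDet_neg_right, neg_mul_neg]

lemma form_left_add_right_pos (hc : c.Proper) : 0 < c.form (c.left + c.right) := by
  have : 0 < planeDet c.left c.right := hc
  simp only [form, planeDet_add_left, planeDet_add_right, planeDet_self, zero_add, add_zero]
  positivity

lemma Proper.coords_ne_zero (hc : c.Proper) (hv : v ≠ 0) :
    planeDet v c.right ≠ 0 ∨ planeDet c.left v ≠ 0 := by
  by_contra! h
  refine hv ((smul_eq_zero.1 ?_).resolve_left hc.ne')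
  rw [planeDet_smul_eq, h.1, h.2, zero_smul, zero_smul, add_zero]

lemma planeDet_mul_planeDet_smul_left (c : PlaneCone) (M : SL(2, ℝ)) (v w : Fin 2 → ℝ) :
    planeDet c.left c.right * planeDet (M • v) w
      = planeDet v c.right * planeDet (M • c.left) w
        + planeDet c.left v * planeDet (M • c.right) w := by
  rw [← planeDet_smul_left, ← smul_comm M, planeDet_smul_eq, smul_add, planeDet_add_left,
    smul_comm, planeDet_smul_left, smul_comm, planeDet_smul_left]

lemma planeDet_mul_planeDet_smul_right (c : PlaneCone) (M : SL(2, ℝ)) (v w : Fin 2 → ℝ) :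
    planeDet c.left c.right * planeDet w (M • v)
      = planeDet v c.right * planeDet w (M • c.left)
        + planeDet c.left v * planeDet w (M • c.right) := by
  simp only [planeDet_comm w, mul_neg, planeDet_mul_planeDet_smul_left c M v w, neg_add]

lemma MapsInside.smul_mem_interior (h : MapsInside M c d) (hc : c.Proper) (hv : v ∈ c.carrier)
    (hv0 : v ≠ 0) : M • v ∈ d.interior := by
  obtain ⟨⟨hR, hP⟩, hS, hQ⟩ := h
  obtain ⟨hy, hx⟩ := hv
  have hcombination {p q : ℝ} (hp : 0 < p) (hq : 0 < q) :
      0 < planeDet v c.right * p + planeDet c.left v * q := by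
    rcases hc.coords_ne_zero hv0 with h | h
    · have := hx.lt_of_ne' h
      positivity
    · have := hy.lt_of_ne' h
      positivity
  constructor <;> refine pos_of_mul_pos_right (a := planeDet c.left c.right) ?_ hc.le
  · rw [planeDet_mul_planeDet_smul_right]
    exact hcombination hR hS
  · rw [planeDet_mul_planeDet_smul_left]
    exact hcombination hP hQ

lemma MapsInside.mono (h : MapsInside M d c') (hd : d.Proper) (hc : c.Proper)
    (hleft : c.left ∈ d.carrier) (hright : c.right ∈ d.carrier) : MapsInside M c c' := by
  have hleft0 : c.left ≠ 0 := fun h0 => by simp [Proper, h0, planeDet] at hc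
  have hright0 : c.right ≠ 0 := fun h0 => by simp [Proper, h0, planeDet] at hc
  exact ⟨h.smul_mem_interior hd hleft hleft0, h.smul_mem_interior hd hright hright0⟩

lemma MapsInside.form_lt (h : MapsInside M c d) (hc : c.Proper) (hd : d.Proper) (hv : v ≠ 0) :
    c.form v < d.form (M • v) := by
  obtain ⟨⟨hR, hP⟩, hS, hQ⟩ := h
  have hx := planeDet_mul_planeDet_smul_left c M v d.right
  have hy := planeDet_mul_planeDet_smul_right c M v d.left
  have hplucker : planeDet (M • c.left) d.right * planeDet d.left (M • c.right)
      - planeDet (M • c.right) d.right * planeDet d.left (M • c.left)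
      = planeDet c.left c.right * planeDet d.left d.right := by
    rw [← planeDet_smul_smul M c.left]
    simp only [planeDet]
    ring
  have hcoords := hc.coords_ne_zero hv
  simp only [form]
  unfold Proper at hc hd
  set D := planeDet c.left c.right
  set D' := planeDet d.left d.right
  set P := planeDet (M • c.left) d.right
  set Q := planeDet (M • c.right) d.right
  set R := planeDet d.left (M • c.left)
  set S := planeDet d.left (M • c.right)
  set x := planeDet v c.right
  set y := planeDet c.left v
  have hdisc : (Q * R) ^ 2 < (P * R) * (Q * S) := by
    have : Q * R < P * S := by nlinarith [mul_pos hc hd]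
    nlinarith [mul_pos hQ hR]
  have hpos : 0 < P * R * x ^ 2 + 2 * (Q * R) * x * y + Q * S * y ^ 2 :=
    pos_of_mul_pos_right (mul_quadratic_pos hdisc hcoords) (mul_pos hP hR).le
  have hdiff : planeDet d.left (M • v) * planeDet (M • v) d.right / D' - y * x / D
      = (P * R * x ^ 2 + 2 * (Q * R) * x * y + Q * S * y ^ 2) / (D ^ 2 * D') := by
    field_simp
    linear_combination (D * planeDet d.left (M • v)) * hx + (x * P + y * Q) * hy
      + x * y * hplucker
  exact sub_pos.1 (hdiff ▸ by positivity)

end PlaneCone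

open PlaneCone in
theorem uniformlyHyperbolic_of_cones {N : ℕ} {A : Fin N → SL(2, ℝ)} {𝒞 : Set PlaneCone}
    (hfin : 𝒞.Finite) (hne : 𝒞.Nonempty) (hproper : ∀ c ∈ 𝒞, c.Proper)
    (hmaps : ∀ c ∈ 𝒞, ∀ i, ∃ d ∈ 𝒞, MapsInside (A i) c d ∨ MapsInside (-A i) c d) :
    UniformlyHyperbolic A := by
  refine uniformlyHyperbolic_of_quadratic_family (hfin.image form) ?_ ?_ ?_ ?_
  · rintro _ ⟨c, -, rfl⟩
    exact c.continuous_form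
  · rintro _ ⟨c, -, rfl⟩
    exact c.form_smul
  · rintro _ ⟨c, hc, rfl⟩ i
    obtain ⟨d, hd, h⟩ := hmaps c hc i
    refine ⟨_, ⟨d, hd, rfl⟩, fun v hv => ?_⟩
    rcases h with h | h
    · exact h.form_lt (hproper c hc) (hproper d hd) hv
    · simpa only [neg_matrix_smul, form_neg] using h.form_lt (hproper c hc) (hproper d hd) hv
  · obtain ⟨c, hc⟩ := hne
    exact ⟨_, ⟨c, hc, rfl⟩, _, form_left_add_right_pos (hproper c hc)⟩

/-- The matrices of determinant one with positive entries. -/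
def positiveSL : Set SL(2, ℝ) := {Q | ∀ i j, 0 < Q i j}

lemma isPreconnected_positiveSL : IsPreconnected positiveSL := by
  let φ : ℝ × ℝ × ℝ → SL(2, ℝ) := fun z =>
    ⟨!![Real.exp z.1, z.2.1; z.2.2, (1 + z.2.1 * z.2.2) * Real.exp (-z.1)], by
      rw [det_fin_two_of, Real.exp_neg]
      field_simp
      ring⟩
  have hφ : Continuous φ := by
    refine Continuous.subtype_mk (continuous_matrix fun i j => ?_) _
    fin_cases i <;> fin_cases j <;> dsimp <;> fun_prop
  have himage : φ '' (Set.univ ×ˢ (Set.Ioi 0 ×ˢ Set.Ioi 0)) = positiveSL := by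
    ext Q
    constructor
    · rintro ⟨⟨w, q, r⟩, ⟨-, hq : 0 < q, hr : 0 < r⟩, rfl⟩ i j
      fin_cases i <;> fin_cases j <;> dsimp [φ] <;> positivity
    · intro hQ
      refine ⟨(Real.log (Q 0 0), Q 0 1, Q 1 0), ⟨trivial, hQ 0 1, hQ 1 0⟩, ?_⟩
      have hQ00 := hQ 0 0
      ext i j
      fin_cases i <;> fin_cases j <;> simp [φ, Real.exp_neg, Real.exp_log hQ00]
      field_simp
      linarith [det_entries Q]
  rw [← himage]
  exact (isPreconnected_univ.prod (isPreconnected_Ioi.prod isPreconnected_Ioi)).image φ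
    hφ.continuousOn

lemma planeDet_smul_right_eq_inv_smul_left (M : SL(2, ℝ)) (v w : Fin 2 → ℝ) :
    planeDet v (M • w) = planeDet (M⁻¹ • v) w := by
  rw [← planeDet_smul_smul M (M⁻¹ • v), smul_inv_smul]

lemma planeDet_smul_left_eq_inv_smul_right (M : SL(2, ℝ)) (v w : Fin 2 → ℝ) :
    planeDet (M • v) w = planeDet v (M⁻¹ • w) := by
  rw [← planeDet_smul_smul M v, smul_inv_smul]

namespace PlaneCone

/-- The positive quadrant. -/
def quadrant : PlaneCone := ⟨![1, 0], ![0, 1]⟩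

lemma mapsInside_quadrant_iff {Q : SL(2, ℝ)} :
    MapsInside Q quadrant quadrant ↔ Q ∈ positiveSL := by
  simp only [MapsInside, quadrant, interior, positiveSL, planeDet, smul_eq_vec, Fin.forall_fin_two,
    Set.mem_ofPred_eq, cons_val_zero, cons_val_one, mul_one, mul_zero, one_mul, zero_mul, add_zero,
    zero_add, sub_zero]
  tauto

/-- A matrix mapping the positive quadrant onto `c`. The factor on the first column makes its
determinant one. -/
noncomputable def frame (c : PlaneCone) (hc : c.Proper) : SL(2, ℝ) :=
  ⟨!![c.left 0 / planeDet c.left c.right, c.right 0;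
      c.left 1 / planeDet c.left c.right, c.right 1], by
    have : planeDet c.left c.right ≠ 0 := hc.ne'
    rw [det_fin_two_of, div_mul_eq_mul_div, mul_div_assoc', ← sub_div, mul_comm (c.right 0)]
    exact div_self this⟩

variable {c d : PlaneCone}

lemma frame_smul_quadrant_left (hc : c.Proper) :
    c.frame hc • quadrant.left = (planeDet c.left c.right)⁻¹ • c.left := by
  rw [smul_eq_vec]
  ext i
  fin_cases i <;> simp [frame, quadrant, div_eq_inv_mul]

lemma frame_smul_quadrant_right (hc : c.Proper) : c.frame hc • quadrant.right = c.right := by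
  rw [smul_eq_vec]
  ext i
  fin_cases i <;> simp [frame, quadrant]

lemma mapsInside_iff_frame (hc : c.Proper) (hd : d.Proper) (M : SL(2, ℝ)) :
    MapsInside M c d ↔ (d.frame hd)⁻¹ * M * c.frame hc ∈ positiveSL := by
  have hc' : 0 < (planeDet c.left c.right)⁻¹ := inv_pos.2 hc
  have hd' : 0 < (planeDet d.left d.right)⁻¹ := inv_pos.2 hd
  simp only [← mapsInside_quadrant_iff, MapsInside, interior, Set.mem_ofPred_eq, mul_smul,
    planeDet_smul_right_eq_inv_smul_left (d.frame hd)⁻¹,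
    planeDet_smul_left_eq_inv_smul_right (d.frame hd)⁻¹, inv_inv, frame_smul_quadrant_left,
    frame_smul_quadrant_right, smul_comm M, planeDet_smul_left, planeDet_smul_right,
    mul_pos_iff_of_pos_left hc', mul_pos_iff_of_pos_left hd']

lemma isPreconnected_setOf_mapsInside (hc : c.Proper) (hd : d.Proper) :
    IsPreconnected {M | MapsInside M c d} := by
  have himage : {M | MapsInside M c d}
      = (fun Q => d.frame hd * Q * (c.frame hc)⁻¹) '' positiveSL := by
    ext M
    rw [Set.mem_ofPred_eq, mapsInside_iff_frame hc hd]
    constructor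
    · intro h
      exact ⟨_, h, by group⟩
    · rintro ⟨Q, hQ, rfl⟩
      convert hQ using 1
      group
  rw [himage]
  exact isPreconnected_positiveSL.image _ (by fun_prop)

end PlaneCone

/-! ### Traces on hyperbolic components -/

lemma planeDet_smul_ne_zero_of_abs_trace_lt_two {M : SL(2, ℝ)}
    (hM : |Matrix.trace (M : Matrix (Fin 2) (Fin 2) ℝ)| < 2) {v : Fin 2 → ℝ} (hv : v ≠ 0) :
    planeDet v (M • v) ≠ 0 := by
  have hdisc : ((M 1 1 - M 0 0) / 2) ^ 2 < M 1 0 * -M 0 1 := by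
    rw [trace_fin_two] at hM
    obtain ⟨hlower, hupper⟩ := abs_lt.1 hM
    nlinarith [det_entries M, mul_pos (neg_lt_iff_pos_add.1 hlower) (sub_pos.2 hupper)]
  have hcoord : v 0 ≠ 0 ∨ v 1 ≠ 0 := by
    by_contra! h
    exact hv (List.ofFn_inj.1 (by simp [h]))
  have hform : planeDet v (M • v)
      = M 1 0 * v 0 ^ 2 + 2 * ((M 1 1 - M 0 0) / 2) * v 0 * v 1 + -M 0 1 * v 1 ^ 2 := by
    simp only [planeDet, smul_eq_vec, cons_val_zero, cons_val_one]
    ring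
  rw [hform]
  exact right_ne_zero_of_mul (mul_quadratic_pos hdisc hcoord).ne'

lemma planeDet_smul_eq_zero_of_tendsto_pow_smul {M : SL(2, ℝ)} {v : Fin 2 → ℝ}
    (h : Tendsto (fun n : ℕ => M ^ n • v) atTop (𝓝 0)) : planeDet v (M • v) = 0 := by
  have hconst (n : ℕ) : planeDet (M ^ n • v) (M • M ^ n • v) = planeDet v (M • v) := by
    rw [smul_smul, ← pow_succ', pow_succ, mul_smul, planeDet_smul_smul]
  have hcont : Continuous fun w : Fin 2 → ℝ => planeDet w (M • w) := by fun_prop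
  have hlim := (hcont.tendsto 0).comp h
  simp only [Function.comp_def, hconst, smul_zero, planeDet_self] at hlim
  exact tendsto_nhds_unique tendsto_const_nhds hlim

section Periodic

variable {N : ℕ} {A : Fin N → SL(2, ℝ)} {x : ℤ → Fin N} {k : ℕ}

lemma forwardProduct_mul_of_isPeriodicPt (hx : Function.IsPeriodicPt shift k x) (n : ℕ) :
    forwardProduct A x (n * k) = forwardProduct A x k ^ n := by
  induction n with
  | zero => simp
  | succ n ih => rw [Nat.succ_mul, forwardProduct_add, (hx.const_mul n).eq, ih, pow_succ']

lemma backwardProduct_mul_of_isPeriodicPt (hx : Function.IsPeriodicPt shift k x) (n : ℕ) :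
    backwardProduct A x (n * k) = (forwardProduct A x k)⁻¹ ^ n := by
  have hinv : Function.LeftInverse shift.symm^[n * k] shift^[n * k] :=
    Function.LeftInverse.iterate (shift (S := Fin N)).symm_apply_apply _
  have hfix : shift.symm^[n * k] x = x := by
    simpa only [(hx.const_mul n).eq] using hinv x
  rw [backwardProduct_eq_inv, hfix, forwardProduct_mul_of_isPeriodicPt hx, inv_pow]

lemma tendsto_smul_of_norm_le {M : ℕ → SL(2, ℝ)} {v : Fin 2 → ℝ} {K l : ℝ} (hl : 0 < l)
    (hl1 : l < 1) (hk : 0 < k) (h : ∀ n, ‖M n • v‖ ≤ K * l ^ n * ‖v‖) :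
    Tendsto (fun n => M (n * k) • v) atTop (𝓝 0) := by
  have hbound : Tendsto (fun n : ℕ => K * l ^ n * ‖v‖) atTop (𝓝 0) := by
    simpa using ((tendsto_pow_atTop_nhds_zero_of_lt_one hl.le hl1).const_mul K).mul_const ‖v‖
  exact (squeeze_zero_norm h hbound).comp (tendsto_id.atTop_mul_const' hk)

lemma UniformlyHyperbolic.exists_eigenvector_of_isPeriodicPt (hA : UniformlyHyperbolic A)
    (hk : 0 < k) (hx : Function.IsPeriodicPt shift k x) :
    ∃ v : Fin 2 → ℝ, v ≠ 0 ∧ planeDet v (forwardProduct A x k • v) = 0 := by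
  obtain ⟨P, -, hP, -, K, l, -, hl, hl1, hs, hu⟩ := hA
  obtain ⟨w, hw⟩ := exists_ne (0 : Fin 2 → ℝ)
  rcases eq_or_ne (P x *ᵥ w) 0 with hker | hrange
  · refine ⟨w, hw, ?_⟩
    have hlim := tendsto_smul_of_norm_le hl hl1 hk fun n => hu x n w hker
    simp only [backwardProduct_mul_of_isPeriodicPt hx] at hlim
    have hzero := planeDet_smul_eq_zero_of_tendsto_pow_smul hlim
    rwa [← planeDet_smul_left_eq_inv_smul_right, planeDet_comm, neg_eq_zero] at hzero
  · refine ⟨P x *ᵥ w, hrange, planeDet_smul_eq_zero_of_tendsto_pow_smul ?_⟩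
    have hlim := tendsto_smul_of_norm_le hl hl1 hk fun n =>
      hs x n (P x *ᵥ w) (by rw [mulVec_mulVec, hP])
    simpa only [forwardProduct_mul_of_isPeriodicPt hx] using hlim

end Periodic

section Trace

variable {N : ℕ} {A : Fin N → SL(2, ℝ)}

lemma exists_isPeriodicPt_forwardProduct_eq (A : Fin N → SL(2, ℝ)) {w : List (Fin N)}
    (hw : w ≠ []) : ∃ x : ℤ → Fin N, Function.IsPeriodicPt shift w.length x ∧
      forwardProduct A x w.length = (w.map A).prod := by
  have hk : 0 < w.length := List.length_pos_iff.2 hw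
  let x : ℤ → Fin N := fun j => w[w.length - 1 - (j % (w.length : ℤ)).toNat]
  have hprod (n : ℕ) (hn : n ≤ w.length) :
      forwardProduct A x n = ((w.drop (w.length - n)).map A).prod := by
    induction n with
    | zero => simp
    | succ n ih =>
      have hxn : x n = w[w.length - (n + 1)] := by
        simp only [x]
        congr 1
        rw [Int.emod_eq_of_lt (by omega) (by omega)]
        omega
      rw [forwardProduct_succ, ih (by omega), hxn,
        List.drop_eq_getElem_cons (show w.length - (n + 1) < w.length by omega), List.map_cons,
        List.prod_cons, show w.length - (n + 1) + 1 = w.length - n by omega]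
  refine ⟨x, ?_, by simpa using hprod w.length le_rfl⟩
  funext j
  rw [iterate_shift_apply]
  simp [x]

theorem two_le_abs_trace_of_mem_hyperbolicLocus (hA : A ∈ hyperbolicLocus N)
    (w : List (Fin N)) : 2 ≤ |Matrix.trace ((w.map A).prod : Matrix (Fin 2) (Fin 2) ℝ)| := by
  by_contra! hlt
  rcases eq_or_ne w [] with rfl | hw
  · simp at hlt
  obtain ⟨x, hx, hprod⟩ := exists_isPeriodicPt_forwardProduct_eq A hw
  obtain ⟨v, hv, hzero⟩ := UniformlyHyperbolic.exists_eigenvector_of_isPeriodicPt hA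
    (List.length_pos_iff.2 hw) hx
  rw [hprod] at hzero
  exact planeDet_smul_ne_zero_of_abs_trace_lt_two hlt hv hzero

lemma disjoint_hyperbolicLocus_ellipticLocus (N : ℕ) :
    Disjoint (hyperbolicLocus N) (ellipticLocus N) :=
  Set.disjoint_left.2 fun _ hA ⟨w, hw⟩ => hw.not_ge (two_le_abs_trace_of_mem_hyperbolicLocus hA w)

lemma continuous_trace_word (w : List (Fin N)) : Continuous fun A : Fin N → SL(2, ℝ) =>
    Matrix.trace ((w.map A).prod : Matrix (Fin 2) (Fin 2) ℝ) := by
  have hprod : Continuous fun A : Fin N → SL(2, ℝ) => (w.map A).prod :=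
    continuous_list_prod w fun i _ => continuous_apply i
  exact (continuous_subtype_val.comp hprod).matrix_trace

lemma trace_word_pos_of_mem_component {A' : Fin N → SL(2, ℝ)}
    (hA' : A' ∈ connectedComponentIn (hyperbolicLocus N) A) {w : List (Fin N)}
    (hw : 0 < Matrix.trace ((w.map A').prod : Matrix (Fin 2) (Fin 2) ℝ)) :
    0 < Matrix.trace ((w.map A).prod : Matrix (Fin 2) (Fin 2) ℝ) := by
  have hA : A ∈ hyperbolicLocus N := connectedComponentIn_nonempty_iff.1 ⟨A', hA'⟩
  by_contra! hle
  obtain ⟨D, hD, hzero⟩ := isPreconnected_connectedComponentIn.intermediate_value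
    (mem_connectedComponentIn hA) hA' (continuous_trace_word w).continuousOn ⟨hle, hw.le⟩
  have htwo := two_le_abs_trace_of_mem_hyperbolicLocus (connectedComponentIn_subset _ _ hD) w
  rw [show Matrix.trace ((w.map D).prod : Matrix (Fin 2) (Fin 2) ℝ) = 0 from hzero,
    abs_zero] at htwo
  exact two_pos.not_ge htwo

end Trace

lemma mem_frontier_of_tendsto {X ι : Type*} [TopologicalSpace X] {l : Filter ι} [NeBot l]
    {s : Set X} {x : X} {f g : ι → X} (hf : Tendsto f l (𝓝 x)) (hfs : ∀ i, f i ∈ s)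
    (hg : Tendsto g l (𝓝 x)) (hgs : ∀ i, g i ∉ s) : x ∈ frontier s := by
  rw [frontier_eq_closure_inter_closure]
  exact ⟨mem_closure_of_tendsto hf (.of_forall hfs), mem_closure_of_tendsto hg (.of_forall hgs)⟩

lemma infinite_setOf_isHyperbolicComponent_inter_nonempty {N : ℕ}
    {K : ℕ → Set (Fin N → SL(2, ℝ))} (hK : ∀ i, IsHyperbolicComponent (K i))
    (hinj : Function.Injective K) {p : ℕ → Fin N → SL(2, ℝ)} (hp : ∀ i, p i ∈ K i)
    {p₀ : Fin N → SL(2, ℝ)} (hlim : Tendsto p atTop (𝓝 p₀)) {V : Set (Fin N → SL(2, ℝ))}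
    (hV : V ∈ 𝓝 p₀) : {H | IsHyperbolicComponent H ∧ (H ∩ V).Nonempty}.Infinite := by
  obtain ⟨n, hn⟩ := eventually_atTop.1 (hlim.eventually hV)
  refine ((Set.Ici_infinite n).image hinj.injOn).mono ?_
  rintro _ ⟨i, hi, rfl⟩
  exact ⟨hK i, p i, hp i, hn i hi⟩

/-! ### The example before the heteroclinic connection -/

/-- The hyperbolic matrix `A` of the example, with `s_A = (1, 0)` and `u_A = (0, 1)`. -/
noncomputable def matA : SL(2, ℝ) := ⟨!![1 / 7, 0; 0, 7], by norm_num [det_fin_two]⟩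

/-- The hyperbolic matrix `B` of the example, with `u_B = (15, -7)` and `s_B = (-7, 15)`. -/
noncomputable def matB : SL(2, ℝ) :=
  ⟨!![98 / 11, 45 / 11; -(45 / 11), -(136 / 77)], by norm_num [det_fin_two]⟩

/-- The path `C` of the example. It is chosen such that `C 0` maps `u_B` to `s_A` and such that
`A * C t * B = C (49 * t)`. -/
noncomputable def matC (t : ℝ) : SL(2, ℝ) :=
  ⟨!![15 / 11, 7 / 11; (7 - 15 * t) / 16, (15 - 7 * t) / 16], by rw [det_fin_two_of]; ring⟩

/-- The vector with coordinates `X, Y` in the eigenbasis of `matB`. -/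
def vecB (X Y : ℝ) : Fin 2 → ℝ := ![15 * X - 7 * Y, 15 * Y - 7 * X]

section Action

lemma matA_smul_vec (x y : ℝ) : matA • ![x, y] = ![x / 7, 7 * y] := by
  rw [smul_eq_vec]
  ext i
  fin_cases i <;> simp [matA]
  ring

lemma neg_matA_smul_vec (x y : ℝ) : -matA • ![x, y] = ![-(x / 7), -(7 * y)] := by
  rw [neg_matrix_smul, matA_smul_vec]
  simp

lemma matB_smul_vecB (X Y : ℝ) : matB • vecB X Y = vecB (7 * X) (Y / 7) := by
  rw [smul_eq_vec]
  ext i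
  fin_cases i <;> simp [matB, vecB] <;> ring

lemma matC_smul_vecB (t X Y : ℝ) : matC t • vecB X Y = ![16 * X, 11 * (Y - t * X)] := by
  rw [smul_eq_vec]
  ext i
  fin_cases i <;> simp [matC, vecB] <;> ring

lemma vec_eq_vecB (x y : ℝ) :
    ![x, y] = vecB ((15 * x + 7 * y) / 176) ((7 * x + 15 * y) / 176) := by
  ext i
  fin_cases i <;> simp [vecB] <;> ring

end Action

section Cones

open PlaneCone

/-- A cone containing the stable direction of `matB` and the unstable direction of `matA`, mapped
into itself by `matA`. -/
def baseCone (l : ℝ) : PlaneCone := ⟨![1, l], vecB 1 4⟩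

/-- The cone between two given slopes in the eigenbasis of `matB`; the unstable direction of
`matB` has slope zero. -/
def unstableCone (a b : ℝ) : PlaneCone := ⟨vecB 1 a, vecB 1 b⟩

/-- The cone between the slopes `-a` and `-b`; the stable direction of `matA` has slope zero. -/
def stableCone (a b : ℝ) : PlaneCone := ⟨![1, -a], ![1, -b]⟩

variable {a b l t x y X Y : ℝ}

lemma proper_baseCone (hl : 0 < l) : (baseCone l).Proper := by
  simp only [Proper, baseCone, planeDet, vecB, cons_val_zero, cons_val_one]
  linarith

lemma proper_unstableCone (hab : a < b) : (unstableCone a b).Proper := by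
  simp only [Proper, unstableCone, planeDet, vecB, cons_val_zero, cons_val_one]
  linarith

lemma proper_stableCone (hba : b < a) : (stableCone a b).Proper := by
  simp only [Proper, stableCone, planeDet, cons_val_zero, cons_val_one]
  linarith

lemma vec_mem_interior_baseCone_iff :
    ![x, y] ∈ (baseCone l).interior ↔ l * x < y ∧ 0 < 53 * x + 13 * y := by
  simp only [PlaneCone.interior, baseCone, planeDet, vecB, Set.mem_ofPred_eq, cons_val_zero,
    cons_val_one]
  constructor <;> rintro ⟨h₁, h₂⟩ <;> constructor <;> linarith

lemma vecB_mem_interior_unstableCone_iff :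
    vecB X Y ∈ (unstableCone a b).interior ↔ a * X < Y ∧ Y < b * X := by
  simp only [PlaneCone.interior, unstableCone, planeDet, vecB, Set.mem_ofPred_eq, cons_val_zero,
    cons_val_one]
  constructor <;> rintro ⟨h₁, h₂⟩ <;> constructor <;> linarith

lemma vecB_mem_carrier_unstableCone (ha : a * X ≤ Y) (hb : Y ≤ b * X) :
    vecB X Y ∈ (unstableCone a b).carrier := by
  simp only [carrier, unstableCone, planeDet, vecB, Set.mem_ofPred_eq, cons_val_zero,
    cons_val_one]
  constructor <;> linarith

lemma vec_mem_interior_stableCone_iff :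
    ![x, y] ∈ (stableCone a b).interior ↔ -(a * x) < y ∧ y < -(b * x) := by
  simp only [PlaneCone.interior, stableCone, planeDet, Set.mem_ofPred_eq, cons_val_zero,
    cons_val_one]
  constructor <;> rintro ⟨h₁, h₂⟩ <;> constructor <;> linarith

lemma matA_mapsInside_baseCone (hl : 0 < l) : MapsInside matA (baseCone l) (baseCone l) := by
  constructor <;> simp only [baseCone, vecB, matA_smul_vec] <;>
    refine vec_mem_interior_baseCone_iff.2 ⟨?_, ?_⟩ <;> linarith

lemma neg_matA_smul_vecB_mem_baseCone (hl : 0 < l) (hX : 0 < X) (hY : 7 * Y ≤ X) :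
    -matA • vecB X Y ∈ (baseCone l).interior := by
  rw [vecB, neg_matA_smul_vec, vec_mem_interior_baseCone_iff]
  constructor <;> nlinarith

lemma neg_matA_smul_vec_mem_baseCone (hl : 0 < l) (hy : y ≤ -(9 / 100)) :
    -matA • ![1, y] ∈ (baseCone l).interior := by
  rw [neg_matA_smul_vec, vec_mem_interior_baseCone_iff]
  constructor <;> linarith

lemma matA_smul_vec_mem_stableCone (h₁ : b < 49 * y) (h₂ : 49 * y < a) :
    matA • ![1, -y] ∈ (stableCone a b).interior := by
  rw [matA_smul_vec, vec_mem_interior_stableCone_iff]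
  constructor <;> linarith

lemma matB_smul_vecB_mem_unstableCone (h₁ : 49 * a < Y) (h₂ : Y < 49 * b) :
    matB • vecB 1 Y ∈ (unstableCone a b).interior := by
  rw [matB_smul_vecB, vecB_mem_interior_unstableCone_iff]
  constructor <;> linarith

-- The direction `(1, y)` has slope `(7 + 15 * y) / (15 + 7 * y)` in the eigenbasis of `matB`.
lemma matB_smul_vec_mem_unstableCone (h₁ : 49 * a * (15 + 7 * y) < 7 + 15 * y)
    (h₂ : 7 + 15 * y < 49 * b * (15 + 7 * y)) :
    matB • ![1, y] ∈ (unstableCone a b).interior := by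
  rw [vec_eq_vecB, matB_smul_vecB, vecB_mem_interior_unstableCone_iff]
  constructor <;> linarith

lemma matC_smul_vecB_mem_stableCone (h₁ : -(16 * a) < 11 * (Y - t))
    (h₂ : 11 * (Y - t) < -(16 * b)) :
    matC t • vecB 1 Y ∈ (stableCone a b).interior := by
  rw [matC_smul_vecB, vec_mem_interior_stableCone_iff]
  constructor <;> linarith

lemma matC_smul_vecB_mem_baseCone (hl : 0 < l) (hX : 0 < X) (h : 16 * l * X < 11 * (Y - t * X)) :
    matC t • vecB X Y ∈ (baseCone l).interior := by
  rw [matC_smul_vecB, vec_mem_interior_baseCone_iff]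
  have := mul_pos hl hX
  constructor <;> linarith

lemma matC_smul_vec_mem_baseCone (hl : 0 < l) (hy : -(1 / 5) ≤ y)
    (h : 16 * l < 11 * (29 / 100 - t)) : matC t • ![1, y] ∈ (baseCone l).interior := by
  rw [vec_eq_vecB]
  have hX : 0 < 15 * 1 + 7 * y := by linarith
  refine matC_smul_vecB_mem_baseCone hl (by positivity) ?_
  nlinarith

end Cones

section Before

open PlaneCone

variable {ε l t : ℝ} {C : SL(2, ℝ)}

lemma matB_mapsInside_baseCone (hε : 0 < ε) (hl : 0 < l) :
    MapsInside matB (baseCone l) (unstableCone (-ε) (1 / 10)) :=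
  ⟨matB_smul_vec_mem_unstableCone (by nlinarith) (by linarith),
    matB_smul_vecB_mem_unstableCone (by linarith) (by norm_num)⟩

lemma matB_mapsInside_unstableCone (hε : 0 < ε) :
    MapsInside matB (unstableCone (-ε) (1 / 10)) (unstableCone (-ε) (1 / 10)) :=
  ⟨matB_smul_vecB_mem_unstableCone (by linarith) (by linarith),
    matB_smul_vecB_mem_unstableCone (by linarith) (by norm_num)⟩

lemma neg_matA_mapsInside_unstableCone (hε : 0 < ε) (hl : 0 < l) :
    MapsInside (-matA) (unstableCone (-ε) (1 / 10)) (baseCone l) :=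
  ⟨neg_matA_smul_vecB_mem_baseCone hl one_pos (by linarith),
    neg_matA_smul_vecB_mem_baseCone hl one_pos (by norm_num)⟩

lemma mem_hyperbolicLocus_of_mapsInside (hε : 0 < ε) (hl : 0 < l)
    (hC : MapsInside C (unstableCone (-ε) 4) (baseCone l)) :
    ![matA, matB, C] ∈ hyperbolicLocus 3 := by
  have hproper : (unstableCone (-ε) 4).Proper := proper_unstableCone (by linarith)
  have hbase : (baseCone l).Proper := proper_baseCone hl
  have hunstable : (unstableCone (-ε) (1 / 10)).Proper := proper_unstableCone (by linarith)
  have hCbase : MapsInside C (baseCone l) (baseCone l) := by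
    refine hC.mono hproper hbase ?_ (vecB_mem_carrier_unstableCone (by linarith) (by norm_num))
    rw [baseCone, vec_eq_vecB]
    exact vecB_mem_carrier_unstableCone (by nlinarith) (by linarith)
  have hCunstable : MapsInside C (unstableCone (-ε) (1 / 10)) (baseCone l) :=
    hC.mono hproper hunstable (vecB_mem_carrier_unstableCone (by linarith) (by linarith))
      (vecB_mem_carrier_unstableCone (by linarith) (by norm_num))
  refine uniformlyHyperbolic_of_cones (𝒞 := {baseCone l, unstableCone (-ε) (1 / 10)})
    (by simp) (by simp) (by rintro _ (rfl | rfl) <;> assumption) ?_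
  rintro _ (rfl | rfl)
  · rw [Fin.forall_fin_succ, Fin.forall_fin_two]
    exact ⟨⟨_, .inl rfl, .inl (matA_mapsInside_baseCone hl)⟩,
      ⟨_, .inr rfl, .inl (matB_mapsInside_baseCone hε hl)⟩, ⟨_, .inl rfl, .inl hCbase⟩⟩
  · rw [Fin.forall_fin_succ, Fin.forall_fin_two]
    exact ⟨⟨_, .inl rfl, .inr (neg_matA_mapsInside_unstableCone hε hl)⟩,
      ⟨_, .inr rfl, .inl (matB_mapsInside_unstableCone hε)⟩, ⟨_, .inl rfl, .inl hCunstable⟩⟩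

lemma neg_matA_mul_matB_mapsInside (hε : 0 < ε) (hl : 0 < l) :
    MapsInside (-(matA * matB)) (unstableCone (-ε) 4) (baseCone l) := by
  constructor <;> simp only [unstableCone, ← neg_mul, mul_smul, matB_smul_vecB] <;>
    exact neg_matA_smul_vecB_mem_baseCone hl (by norm_num) (by linarith)

lemma matC_mapsInside (hl : 0 < l) (hε : 0 < ε) (h : 16 * l < 11 * (-ε - t)) :
    MapsInside (matC t) (unstableCone (-ε) 4) (baseCone l) :=
  ⟨matC_smul_vecB_mem_baseCone hl one_pos (by linarith),
    matC_smul_vecB_mem_baseCone hl one_pos (by linarith)⟩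

/-- The hyperbolic component `H` of `(A, B, -AB)`. -/
def componentBefore : Set (Fin 3 → SL(2, ℝ)) :=
  connectedComponentIn (hyperbolicLocus 3) ![matA, matB, -(matA * matB)]

lemma neg_matA_mul_matB_mem_hyperbolicLocus :
    ![matA, matB, -(matA * matB)] ∈ hyperbolicLocus 3 :=
  mem_hyperbolicLocus_of_mapsInside one_pos one_pos (neg_matA_mul_matB_mapsInside one_pos one_pos)

lemma isHyperbolicComponent_componentBefore : IsHyperbolicComponent componentBefore :=
  ⟨_, neg_matA_mul_matB_mem_hyperbolicLocus, rfl⟩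

lemma neg_matA_mul_matB_mem_componentBefore :
    ![matA, matB, -(matA * matB)] ∈ componentBefore :=
  mem_connectedComponentIn neg_matA_mul_matB_mem_hyperbolicLocus

lemma continuous_vec_matA_matB : Continuous fun C => (![matA, matB, C] : Fin 3 → SL(2, ℝ)) :=
  continuous_const.matrixVecCons
    (continuous_const.matrixVecCons (continuous_id.matrixVecCons continuous_const))

lemma matC_mem_componentBefore (ht : t < 0) : ![matA, matB, matC t] ∈ componentBefore := by
  have hε : 0 < -t / 2 := by linarith
  have hl : 0 < -t / 100 := by linarith
  have hproper : (unstableCone (-(-t / 2)) 4).Proper := proper_unstableCone (by linarith)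
  have hconn := (isPreconnected_setOf_mapsInside hproper (proper_baseCone hl)).image _
    continuous_vec_matA_matB.continuousOn
  refine hconn.subset_connectedComponentIn
    (Set.mem_image_of_mem _ (neg_matA_mul_matB_mapsInside hε hl)) ?_
    (Set.mem_image_of_mem _ (matC_mapsInside hl hε (by linarith)))
  rintro _ ⟨C, hC, rfl⟩
  exact mem_hyperbolicLocus_of_mapsInside hε hl hC

end Before

/-! ### The example after the heteroclinic connection -/

section After

open PlaneCone

/-- A cone of directions close to those of size `q` next to the unstable direction of `matB`; the
tolerance decreases with `s` so that `matB` maps such cones strictly inside each other. -/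
noncomputable def approachCone (s q : ℝ) : PlaneCone :=
  unstableCone ((27 / 100 + s / 50) * q) ((5 - s) * q)

/-- The cone around the unstable direction of `matB` which does not contain the preimage of the
stable direction of `matA` under `matC (u / 4)`. -/
noncomputable def coreCone (u : ℝ) : PlaneCone := unstableCone (-u / 60) (5 * u / 49)

/-- A cone of directions close to those of size `r` next to the stable direction of `matA`; the
tolerance decreases with `s` so that `matA` maps such cones strictly inside each other. -/
noncomputable def departCone (s r : ℝ) : PlaneCone :=
  stableCone ((1 / 5 - s / 100) * r) ((9 / 100 + s / 100) * r)

variable {l q r s u : ℝ}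

lemma proper_approachCone (hs : s ≤ 1) (hq : 0 < q) : (approachCone s q).Proper :=
  proper_unstableCone (by nlinarith)

lemma proper_coreCone (hu : 0 < u) : (coreCone u).Proper := proper_unstableCone (by linarith)

lemma proper_departCone (hs : s ≤ 1) (hr : 0 < r) : (departCone s r).Proper :=
  proper_stableCone (by nlinarith)

lemma matB_mapsInside_baseCone_approachCone (hl : 0 < l) :
    MapsInside matB (baseCone l) (approachCone (1 / 2) (1 / 49)) :=
  ⟨matB_smul_vec_mem_unstableCone (by linarith) (by linarith),
    matB_smul_vecB_mem_unstableCone (by norm_num) (by norm_num)⟩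

lemma matB_mapsInside_approachCone (hs : 0 < s) (hs1 : s ≤ 1) (hq : 0 < q) :
    MapsInside matB (approachCone s q) (approachCone (s / 2) (q / 49)) := by
  have := mul_pos hs hq
  constructor <;> apply matB_smul_vecB_mem_unstableCone <;> nlinarith

lemma matB_mapsInside_approachCone_coreCone (hs : 0 < s) (hs1 : s ≤ 1) (hu : 0 < u) :
    MapsInside matB (approachCone s u) (coreCone u) := by
  have := mul_pos hs hu
  constructor <;> apply matB_smul_vecB_mem_unstableCone <;> nlinarith

lemma matB_mapsInside_coreCone (hu : 0 < u) : MapsInside matB (coreCone u) (coreCone u) := by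
  constructor <;> apply matB_smul_vecB_mem_unstableCone <;> linarith

lemma departCone_slope_bounds (hs : 0 < s) (hs1 : s ≤ 1) (hr : 0 < r) (hr1 : r ≤ 1) :
    -(1 / 5) ≤ -((1 / 5 - s / 100) * r) ∧ -(1 / 5) ≤ -((9 / 100 + s / 100) * r) := by
  constructor <;> nlinarith [mul_pos hs hr]

lemma matB_mapsInside_departCone_approachCone (hs : 0 < s) (hs1 : s ≤ 1) (hr : 0 < r)
    (hr1 : r ≤ 1) : MapsInside matB (departCone s r) (approachCone (1 / 2) (1 / 49)) := by
  obtain ⟨h₁, h₂⟩ := departCone_slope_bounds hs hs1 hr hr1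
  constructor <;> apply matB_smul_vec_mem_unstableCone <;> linarith

lemma matC_mapsInside_approachCone (hs : 0 < s) (hs1 : s ≤ 1) (hu : 0 < u) (huq : u ≤ q) :
    MapsInside (matC (u / 4)) (approachCone s q) (baseCone (u / 100)) := by
  have := mul_pos hs (hu.trans_le huq)
  constructor <;> apply matC_smul_vecB_mem_baseCone <;> nlinarith

lemma matC_mapsInside_coreCone (hu : 0 < u) :
    MapsInside (matC (u / 4)) (coreCone u) (departCone 1 u) := by
  constructor <;> apply matC_smul_vecB_mem_stableCone <;> linarith

lemma matC_mapsInside_baseCone (hu : 0 < u) (hu1 : u ≤ 1) :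
    MapsInside (matC (u / 4)) (baseCone (u / 100)) (baseCone (u / 100)) :=
  ⟨matC_smul_vec_mem_baseCone (by linarith) (by linarith) (by linarith),
    matC_smul_vecB_mem_baseCone (by linarith) one_pos (by linarith)⟩

lemma matC_mapsInside_departCone (hs : 0 < s) (hs1 : s ≤ 1) (hr : 0 < r) (hr1 : r ≤ 1)
    (hu : 0 < u) (hu1 : u ≤ 1) :
    MapsInside (matC (u / 4)) (departCone s r) (baseCone (u / 100)) := by
  obtain ⟨h₁, h₂⟩ := departCone_slope_bounds hs hs1 hr hr1
  constructor <;> apply matC_smul_vec_mem_baseCone <;> linarith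

lemma neg_matA_mapsInside_approachCone (hs : 0 < s) (hs1 : s ≤ 1) (hq : 0 < q) (hq1 : q ≤ 1 / 49)
    (hl : 0 < l) : MapsInside (-matA) (approachCone s q) (baseCone l) := by
  have := mul_pos hs hq
  constructor <;> refine neg_matA_smul_vecB_mem_baseCone hl one_pos ?_ <;> nlinarith

lemma neg_matA_mapsInside_coreCone (hu : 0 < u) (hu1 : u ≤ 1) (hl : 0 < l) :
    MapsInside (-matA) (coreCone u) (baseCone l) := by
  constructor <;> refine neg_matA_smul_vecB_mem_baseCone hl one_pos ?_ <;> linarith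

lemma matA_mapsInside_departCone (hs : 0 < s) (hs1 : s ≤ 1) (hr : 0 < r) :
    MapsInside matA (departCone s r) (departCone (s / 2) (49 * r)) := by
  have := mul_pos hs hr
  constructor <;> apply matA_smul_vec_mem_stableCone <;> nlinarith

lemma neg_matA_mapsInside_departCone_one (hs : 0 < s) (hs1 : s ≤ 1) (hl : 0 < l) :
    MapsInside (-matA) (departCone s 1) (baseCone l) := by
  constructor <;> refine neg_matA_smul_vec_mem_baseCone hl ?_ <;> linarith

/-- The cones followed by the orbits of `matA`, `matB` and `matC ((1 / 49) ^ n / 4)`: an orbit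
entering the cones `approachCone` is pushed towards the unstable direction of `matB`, is mapped
from `coreCone` next to the stable direction of `matA`, and needs `n` steps to leave it. -/
def conesAfter (n : ℕ) : Set PlaneCone :=
  {baseCone ((1 / 49) ^ n / 100), coreCone ((1 / 49) ^ n)} ∪
    ((fun k : ℕ => approachCone ((1 / 2) ^ k) ((1 / 49) ^ k)) '' Set.Icc 1 n ∪
      (fun j : ℕ => departCone ((1 / 2) ^ j) (49 ^ j * (1 / 49) ^ n)) '' Set.Iic n)

section Family

variable {j k n : ℕ}

lemma baseCone_mem_conesAfter : baseCone ((1 / 49) ^ n / 100) ∈ conesAfter n := .inl (.inl rfl)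

lemma coreCone_mem_conesAfter : coreCone ((1 / 49) ^ n) ∈ conesAfter n := .inl (.inr rfl)

lemma approachCone_mem_conesAfter (hk : 1 ≤ k) (hkn : k ≤ n) :
    approachCone ((1 / 2) ^ k) ((1 / 49) ^ k) ∈ conesAfter n :=
  .inr (.inl ⟨k, ⟨hk, hkn⟩, rfl⟩)

lemma departCone_mem_conesAfter (hjn : j ≤ n) :
    departCone ((1 / 2) ^ j) (49 ^ j * (1 / 49) ^ n) ∈ conesAfter n :=
  .inr (.inr ⟨j, hjn, rfl⟩)

lemma finite_conesAfter (n : ℕ) : (conesAfter n).Finite :=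
  (Set.toFinite _).union (((Set.finite_Icc 1 n).image _).union ((Set.finite_Iic n).image _))

lemma half_pow_le_one (k : ℕ) : (1 / 2 : ℝ) ^ k ≤ 1 := pow_le_one₀ (by norm_num) (by norm_num)

lemma inv_pow_le_one (k : ℕ) : (1 / 49 : ℝ) ^ k ≤ 1 := pow_le_one₀ (by norm_num) (by norm_num)

lemma pow_mul_inv_pow_self (n : ℕ) : (49 : ℝ) ^ n * (1 / 49) ^ n = 1 := by
  rw [← mul_pow]
  norm_num

lemma pow_mul_inv_pow_le_one (hjn : j ≤ n) : (49 : ℝ) ^ j * (1 / 49) ^ n ≤ 1 :=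
  calc (49 : ℝ) ^ j * (1 / 49) ^ n ≤ 49 ^ n * (1 / 49) ^ n := by gcongr; norm_num
    _ = 1 := pow_mul_inv_pow_self n

lemma proper_of_mem_conesAfter {c : PlaneCone} (hc : c ∈ conesAfter n) : c.Proper := by
  rcases hc with (rfl | rfl) | ⟨k, -, rfl⟩ | ⟨j, -, rfl⟩
  · exact proper_baseCone (by positivity)
  · exact proper_coreCone (by positivity)
  · exact proper_approachCone (half_pow_le_one k) (by positivity)
  · exact proper_departCone (half_pow_le_one j) (by positivity)

lemma exists_mapsInside_matA {c : PlaneCone} (hc : c ∈ conesAfter n) :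
    ∃ d ∈ conesAfter n, MapsInside matA c d ∨ MapsInside (-matA) c d := by
  rcases hc with (rfl | rfl) | ⟨k, hk, rfl⟩ | ⟨j, hj, rfl⟩
  · exact ⟨_, baseCone_mem_conesAfter, .inl (matA_mapsInside_baseCone (by positivity))⟩
  · exact ⟨_, baseCone_mem_conesAfter, .inr
      (neg_matA_mapsInside_coreCone (by positivity) (inv_pow_le_one n) (by positivity))⟩
  · have hk49 : (1 / 49 : ℝ) ^ k ≤ 1 / 49 :=
      pow_le_of_le_one (by norm_num) (by norm_num) (Nat.one_le_iff_ne_zero.1 hk.1)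
    exact ⟨_, baseCone_mem_conesAfter, .inr (neg_matA_mapsInside_approachCone (by positivity)
      (half_pow_le_one k) (by positivity) hk49 (by positivity))⟩
  · rcases eq_or_lt_of_le (show j ≤ n from hj) with rfl | hjn
    · refine ⟨_, baseCone_mem_conesAfter, .inr ?_⟩
      simp only [pow_mul_inv_pow_self]
      exact neg_matA_mapsInside_departCone_one (by positivity) (half_pow_le_one j) (by positivity)
    · refine ⟨_, departCone_mem_conesAfter (j := j + 1) hjn, .inl ?_⟩
      convert matA_mapsInside_departCone (s := (1 / 2) ^ j) (r := 49 ^ j * (1 / 49) ^ n)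
        (by positivity) (half_pow_le_one j) (by positivity) using 2 <;> ring

lemma exists_mapsInside_matB (hn : 1 ≤ n) {c : PlaneCone} (hc : c ∈ conesAfter n) :
    ∃ d ∈ conesAfter n, MapsInside matB c d := by
  have hfirst : approachCone (1 / 2) (1 / 49) ∈ conesAfter n := by
    simpa only [pow_one] using approachCone_mem_conesAfter le_rfl hn
  rcases hc with (rfl | rfl) | ⟨k, hk, rfl⟩ | ⟨j, hj, rfl⟩
  · exact ⟨_, hfirst, matB_mapsInside_baseCone_approachCone (by positivity)⟩
  · exact ⟨_, coreCone_mem_conesAfter, matB_mapsInside_coreCone (by positivity)⟩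
  · rcases hk.2.eq_or_lt with rfl | hkn
    · exact ⟨_, coreCone_mem_conesAfter, matB_mapsInside_approachCone_coreCone (by positivity)
        (half_pow_le_one k) (by positivity)⟩
    · refine ⟨_, approachCone_mem_conesAfter (k := k + 1) le_add_self hkn, ?_⟩
      convert matB_mapsInside_approachCone (s := (1 / 2) ^ k) (q := (1 / 49) ^ k)
        (by positivity) (half_pow_le_one k) (by positivity) using 2 <;> ring
  · exact ⟨_, hfirst, matB_mapsInside_departCone_approachCone (by positivity) (half_pow_le_one j)
      (by positivity) (pow_mul_inv_pow_le_one hj)⟩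

lemma exists_mapsInside_matC {c : PlaneCone} (hc : c ∈ conesAfter n) :
    ∃ d ∈ conesAfter n, MapsInside (matC ((1 / 49) ^ n / 4)) c d := by
  have hu : (0 : ℝ) < (1 / 49) ^ n := by positivity
  rcases hc with (rfl | rfl) | ⟨k, hk, rfl⟩ | ⟨j, hj, rfl⟩
  · exact ⟨_, baseCone_mem_conesAfter, matC_mapsInside_baseCone hu (inv_pow_le_one n)⟩
  · refine ⟨_, departCone_mem_conesAfter n.zero_le, ?_⟩
    simpa only [pow_zero, one_mul] using matC_mapsInside_coreCone hu
  · exact ⟨_, baseCone_mem_conesAfter, matC_mapsInside_approachCone (by positivity)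
      (half_pow_le_one k) hu (pow_le_pow_of_le_one (by norm_num) (by norm_num) hk.2)⟩
  · exact ⟨_, baseCone_mem_conesAfter, matC_mapsInside_departCone (by positivity)
      (half_pow_le_one j) (by positivity) (pow_mul_inv_pow_le_one hj) hu (inv_pow_le_one n)⟩

theorem matC_mem_hyperbolicLocus (hn : 1 ≤ n) :
    ![matA, matB, matC ((1 / 49) ^ n / 4)] ∈ hyperbolicLocus 3 := by
  refine uniformlyHyperbolic_of_cones (finite_conesAfter n) ⟨_, baseCone_mem_conesAfter⟩
    (fun _ => proper_of_mem_conesAfter) fun c hc => ?_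
  obtain ⟨d, hd, hB⟩ := exists_mapsInside_matB hn hc
  obtain ⟨e, he, hC⟩ := exists_mapsInside_matC hc
  rw [Fin.forall_fin_succ, Fin.forall_fin_two]
  exact ⟨exists_mapsInside_matA hc, ⟨d, hd, .inl hB⟩, ⟨e, he, .inl hC⟩⟩

end Family

end After

section Path

lemma contDiff_matC (i j : Fin 2) : ContDiff ℝ ∞ fun t => matC t i j := by
  fin_cases i <;> fin_cases j <;> dsimp [matC] <;> fun_prop

lemma continuous_path : Continuous fun t => (![matA, matB, matC t] : Fin 3 → SL(2, ℝ)) :=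
  continuous_vec_matA_matB.comp <|
    Continuous.subtype_mk (continuous_matrix fun i j => (contDiff_matC i j).continuous) _

lemma tendsto_path {α : Type*} {l : Filter α} {u : α → ℝ} (hu : Tendsto u l (𝓝 0)) :
    Tendsto (fun a => ![matA, matB, matC (u a)]) l (𝓝 ![matA, matB, matC 0]) :=
  (continuous_path.tendsto 0).comp hu

lemma matA_mul_matC_mul_matB (t : ℝ) : matA * matC t * matB = matC (49 * t) := by
  ext i j
  rw [Matrix.SpecialLinearGroup.coe_mul, Matrix.SpecialLinearGroup.coe_mul]
  fin_cases i <;> fin_cases j <;>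
    simp [matA, matB, matC, mul_apply] <;> ring

/-- The word whose product is `Aⁿ C Bⁿ`. -/
def heteroclinicWord (n : ℕ) : List (Fin 3) := List.replicate n 0 ++ 2 :: List.replicate n 1

lemma prod_heteroclinicWord (n : ℕ) (t : ℝ) :
    ((heteroclinicWord n).map ![matA, matB, matC t]).prod = matC (49 ^ n * t) := by
  have hpow : matA ^ n * matC t * matB ^ n = matC (49 ^ n * t) := by
    induction n with
    | zero => simp
    | succ n ih =>
      calc matA ^ (n + 1) * matC t * matB ^ (n + 1)
          = matA * (matA ^ n * matC t * matB ^ n) * matB := by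
            rw [pow_succ', pow_succ]
            simp only [mul_assoc]
        _ = matC (49 ^ (n + 1) * t) := by
            rw [ih, matA_mul_matC_mul_matB, ← mul_assoc, ← pow_succ']
  rw [← hpow]
  simp [heteroclinicWord, mul_assoc]

lemma trace_heteroclinicWord (n : ℕ) (t : ℝ) :
    Matrix.trace (((heteroclinicWord n).map ![matA, matB, matC t]).prod :
      Matrix (Fin 2) (Fin 2) ℝ) = 15 / 11 + (15 - 7 * (49 ^ n * t)) / 16 := by
  rw [prod_heteroclinicWord]
  exact trace_fin_two_of _ _ _ _

lemma path_mem_ellipticLocus (n : ℕ) :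
    ![matA, matB, matC ((1 / 49) ^ n * (405 / 77))] ∈ ellipticLocus 3 := by
  refine ⟨heteroclinicWord n, ?_⟩
  rw [trace_heteroclinicWord, ← mul_assoc ((49 : ℝ) ^ n), pow_mul_inv_pow_self]
  norm_num

lemma tendsto_inv_pow_mul (c : ℝ) : Tendsto (fun n : ℕ => (1 / 49 : ℝ) ^ n * c) atTop (𝓝 0) := by
  simpa only [zero_mul] using
    (tendsto_pow_atTop_nhds_zero_of_lt_one (by norm_num) (by norm_num)).mul_const c

lemma path_mem_frontier : ![matA, matB, matC 0] ∈ frontier componentBefore :=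
  mem_frontier_of_tendsto (tendsto_path (tendsto_inv_pow_mul (-1)))
    (fun n => matC_mem_componentBefore (mul_neg_of_pos_of_neg (by positivity) (by norm_num)))
    (tendsto_path (tendsto_inv_pow_mul (405 / 77)))
    fun n hn => Set.disjoint_left.1 (disjoint_hyperbolicLocus_ellipticLocus 3)
      (connectedComponentIn_subset _ _ hn) (path_mem_ellipticLocus n)

end Path

section ComponentsAfter

/-- The `i`-th parameter after the heteroclinic connection at which the triple is hyperbolic. -/
noncomputable def parameterAfter (i : ℕ) : ℝ := (1 / 49) ^ (i + 1) / 4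

lemma parameterAfter_pos (i : ℕ) : 0 < parameterAfter i := by
  rw [parameterAfter]
  positivity

lemma tendsto_parameterAfter : Tendsto parameterAfter atTop (𝓝 0) :=
  (tendsto_add_atTop_iff_nat 1).2 (tendsto_inv_pow_mul 4⁻¹)

/-- The hyperbolic component which contains the path at `parameterAfter i`. -/
def componentAfter (i : ℕ) : Set (Fin 3 → SL(2, ℝ)) :=
  connectedComponentIn (hyperbolicLocus 3) ![matA, matB, matC (parameterAfter i)]

lemma path_mem_hyperbolicLocus (i : ℕ) :
    ![matA, matB, matC (parameterAfter i)] ∈ hyperbolicLocus 3 :=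
  matC_mem_hyperbolicLocus le_add_self

lemma path_mem_componentAfter (i : ℕ) :
    ![matA, matB, matC (parameterAfter i)] ∈ componentAfter i :=
  mem_connectedComponentIn (path_mem_hyperbolicLocus i)

lemma isHyperbolicComponent_componentAfter (i : ℕ) : IsHyperbolicComponent (componentAfter i) :=
  ⟨_, path_mem_hyperbolicLocus i, rfl⟩

lemma trace_heteroclinicWord_parameterAfter_pos (i : ℕ) :
    0 < Matrix.trace (((heteroclinicWord (i + 1)).map ![matA, matB, matC (parameterAfter i)]).prod :
      Matrix (Fin 2) (Fin 2) ℝ) := by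
  rw [trace_heteroclinicWord, parameterAfter, mul_div_assoc', pow_mul_inv_pow_self]
  norm_num

lemma trace_heteroclinicWord_parameterAfter_nonpos {i j : ℕ} (hij : i < j) :
    Matrix.trace (((heteroclinicWord (j + 1)).map ![matA, matB, matC (parameterAfter i)]).prod :
      Matrix (Fin 2) (Fin 2) ℝ) ≤ 0 := by
  have hlarge : (49 : ℝ) ≤ 49 ^ (j + 1) * (1 / 49) ^ (i + 1) :=
    calc (49 : ℝ) = 49 * (49 ^ (i + 1) * (1 / 49) ^ (i + 1)) := by
          rw [pow_mul_inv_pow_self, mul_one]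
      _ = 49 ^ (i + 1 + 1) * (1 / 49) ^ (i + 1) := by ring
      _ ≤ 49 ^ (j + 1) * (1 / 49) ^ (i + 1) := by
          gcongr
          · norm_num
          · exact hij
  rw [trace_heteroclinicWord, parameterAfter, mul_div_assoc']
  linarith

lemma injective_componentAfter : Function.Injective componentAfter := by
  refine Function.Injective.of_lt_imp_ne fun i j hij heq => ?_
  have hmem : ![matA, matB, matC (parameterAfter j)] ∈ componentAfter i :=
    heq ▸ path_mem_componentAfter j
  exact (trace_heteroclinicWord_parameterAfter_nonpos hij).not_gt
    (trace_word_pos_of_mem_component hmem (trace_heteroclinicWord_parameterAfter_pos j))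

end ComponentsAfter

section FixedDirections

lemma matB_smul_vec (x y : ℝ) :
    matB • ![x, y] = ![98 / 11 * x + 45 / 11 * y, -(45 / 11) * x - 136 / 77 * y] := by
  rw [vec_eq_vecB, matB_smul_vecB, vecB]
  ext i
  fin_cases i <;> dsimp <;> ring

lemma spansStable_matA {x : ℝ} (hx : x ≠ 0) : SpansStable matA ![x, 0] := by
  refine ⟨by simpa using hx, 1 / 7, by norm_num [abs_lt], ?_⟩
  rw [mulVec_eq_smul, matA_smul_vec]
  ext i
  fin_cases i <;> dsimp <;> ring

lemma spansUnstable_matA : SpansUnstable matA ![0, 1] :=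
  ⟨by simp, 7, by norm_num, by rw [mulVec_eq_smul, matA_smul_vec]; norm_num⟩

lemma spansStable_matB : SpansStable matB ![-7, 15] :=
  ⟨by simp, 1 / 7, by norm_num [abs_lt], by rw [mulVec_eq_smul, matB_smul_vec]; norm_num⟩

lemma spansUnstable_matB : SpansUnstable matB ![15, -7] :=
  ⟨by simp, 7, by norm_num, by rw [mulVec_eq_smul, matB_smul_vec]; norm_num⟩

lemma spansStable_matA_mul_matB : SpansStable (matA * matB) ![-3, 7] :=
  ⟨by simp, -1 / 11, by norm_num [abs_lt], by
    rw [mulVec_eq_smul, mul_smul, matB_smul_vec, matA_smul_vec]; norm_num⟩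

lemma spansUnstable_matA_mul_matB : SpansUnstable (matA * matB) ![-1, 21] :=
  ⟨by simp, -11, by norm_num, by
    rw [mulVec_eq_smul, mul_smul, matB_smul_vec, matA_smul_vec]; norm_num⟩

lemma spansStable_matB_mul_matA : SpansStable (matB * matA) ![21, -1] :=
  ⟨by simp, -1 / 11, by norm_num [abs_lt], by
    rw [mulVec_eq_smul, mul_smul, matA_smul_vec, matB_smul_vec]; norm_num⟩

lemma spansUnstable_matB_mul_matA : SpansUnstable (matB * matA) ![7, -3] :=
  ⟨by simp, -11, by norm_num, by
    rw [mulVec_eq_smul, mul_smul, matA_smul_vec, matB_smul_vec]; norm_num⟩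

lemma inPositiveFreeComponent_matA_matB : InPositiveFreeComponent matA matB := by
  refine ⟨by norm_num [matA], by norm_num [matB], ?_, _, _, _, _, _, _, _, _, spansUnstable_matB,
    spansUnstable_matB_mul_matA, spansStable_matB_mul_matA, spansStable_matA one_ne_zero,
    spansUnstable_matA, spansUnstable_matA_mul_matB, spansStable_matA_mul_matB, spansStable_matB,
    cyclicallyOrdered_of_planeDet_pos fun i j hij => ?_⟩
  · rw [Matrix.SpecialLinearGroup.coe_mul, trace_fin_two]
    norm_num [matA, matB, mul_apply]
  · fin_cases i <;> fin_cases j <;> first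
      | exact absurd hij (by decide)
      | norm_num [planeDet]

lemma heteroclinicConnection_matC_zero : HeteroclinicConnection matA matB (matC 0) := by
  refine ⟨_, spansUnstable_matB, ?_⟩
  have hconn : matC 0 • ![(15 : ℝ), -7] = ![16, 0] := by
    rw [vec_eq_vecB, matC_smul_vecB]
    norm_num
  rw [mulVec_eq_smul, hconn]
  exact spansStable_matA (by norm_num)

end FixedDirections

theorem proposition4p15 :
    ∃ H : Set (Fin 3 → SL(2, ℝ)), IsHyperbolicComponent H ∧
      (∃ A₀ B₀ : SL(2, ℝ), InPositiveFreeComponent A₀ B₀ ∧ ![A₀, B₀, -(A₀ * B₀)] ∈ H) ∧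
      ∃ (A B : SL(2, ℝ)) (C : ℝ → SL(2, ℝ)),
        (∀ i j : Fin 2, ContDiff ℝ ∞ (fun t : ℝ => C t i j)) ∧
        (∀ t : ℝ, t < 0 → ![A, B, C t] ∈ H) ∧
        (HeteroclinicConnection A B (C 0) ∧ ![A, B, C 0] ∈ frontier H) ∧
        (∃ (K : ℕ → Set (Fin 3 → SL(2, ℝ))) (t : ℕ → ℝ),
          (∀ i, IsHyperbolicComponent (K i)) ∧ Function.Injective K ∧
          (∀ i, 0 < t i) ∧ Tendsto t atTop (𝓝 0) ∧ ∀ i, ![A, B, C (t i)] ∈ K i) ∧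
        (∃ s : ℕ → ℝ, (∀ i, 0 < s i) ∧ Tendsto s atTop (𝓝 0) ∧
          ∀ i, ![A, B, C (s i)] ∈ ellipticLocus 3) ∧
        (∀ V ∈ 𝓝 (![A, B, C 0] : Fin 3 → SL(2, ℝ)),
          {K : Set (Fin 3 → SL(2, ℝ)) |
            IsHyperbolicComponent K ∧ (K ∩ V).Nonempty}.Infinite) := by
  refine ⟨componentBefore, isHyperbolicComponent_componentBefore,
    ⟨matA, matB, inPositiveFreeComponent_matA_matB, neg_matA_mul_matB_mem_componentBefore⟩,
    matA, matB, matC, contDiff_matC, fun t => matC_mem_componentBefore,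
    ⟨heteroclinicConnection_matC_zero, path_mem_frontier⟩,
    ⟨componentAfter, parameterAfter, isHyperbolicComponent_componentAfter,
      injective_componentAfter, parameterAfter_pos, tendsto_parameterAfter,
      path_mem_componentAfter⟩,
    ⟨fun n => (1 / 49) ^ n * (405 / 77), fun n => by positivity, tendsto_inv_pow_mul _,
      path_mem_ellipticLocus⟩,
    fun V => infinite_setOf_isHyperbolicComponent_inter_nonempty
      isHyperbolicComponent_componentAfter injective_componentAfter path_mem_componentAfter
      (tendsto_path tendsto_parameterAfter)⟩
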